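/- For $c,\kappa\in\mathbb R$ consider the travelling wave equation $$ icu'+u''+u(1-|u|^2)+\kappa u(1-|u|^2)''=0 \quad\text{in }\mathbb R, \qquad (\mathrm{TW}(c,\kappa))$$ and the energy space $\mathcal X(\mathbb R)=\{u\in H^1_{\rm loc}(\mathbb R;\mathbb C):\ 1-|u|^2\in L^2(\mathbb R),\ u'\in L^2(\mathbb R)\}$, whose elements are identified with their continuous representatives. With $\langle z,w\rangle=\mathrm{Re}\,z\,\mathrm{Re}\,w+\mathrm{Im}\,z\,\mathrm{Im}\,w$, a function $u\in\mathcal X(\mathbb R)$ is a (weak) solution of $(\mathrm{TW}(c,\kappa))$ if $$\int_{\mathbb R}\langle icu'+u(1-|u|^2),\phi\rangle-\langle u',\phi'\rangle+2\kappa\langle u,u'\rangle\langle u,\phi\rangle'=0\quad\text{for all }\phi\in C_c^\infty(\mathbb R;\mathbb C);$$ it is trivial if it is a constant of modulus one. Put $$\Gamma(u)=\{x\in\mathbb R:\ |u(x)|^2=1/(2\kappa)\},\qquad \mathcal N(u)=\{x\in\mathbb R:\ u\text{ is not differentiable at }x\}.$$ Let $$\mathcal D_1=\{0\le c<\sqrt2,\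 0<\kappa<\tfrac12\},\quad \mathcal D_3=\{c>\sqrt2,\ \kappa>\tfrac12\},\quad \mathcal B_-=\{c=\sqrt2,\ 0<\kappa<\tfrac12\},\quad \mathcal B_+=\{c=\sqrt2,\ \kappa>\tfrac12\},$$ and $\tilde{\mathcal D}=\mathcal D_1\cup\mathcal D_3\cup\mathcal B_-\cup\mathcal B_+$. Let $I_\kappa=[1-\frac1{2\kappa},0)$ if $0<\kappa<\frac12$ and $I_\kappa=(0,1-\frac1{2\kappa}]$ if $\kappa>\frac12$. For $(c,\kappa)\in\tilde{\mathcal D}$ and $y\in I_\kappa$ put $$F(y)=2\sqrt\kappa\,\mathrm{atan}\Big(\sqrt\kappa\sqrt{\tfrac{2-c^2-2y}{1-2\kappa+2\kappa y}}\Big)+2\sqrt{\tfrac{1-2\kappa}{2-c^2}}\,\mathrm{atanh}\Big(\sqrt{\tfrac{(2-c^2)(1-2\kappa+2\kappa y)}{(1-2\kappa)(2-c^2-2y)}}\Big)-\pi\sqrt\kappa\quad\text{if }c\ne\sqrt2,$$ $$F(y)=2\sqrt\kappa\,\mathrm{atan}\Big(\sqrt{\tfrac{-2\kappa y}{1-2\kappa+2\kappa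 y}}\Big)+\sqrt2\sqrt{-\tfrac{1-2\kappa+2\kappa y}{y}}-\pi\sqrt\kappa\quad\text{if }c=\sqrt2,$$ where at the endpoint $y=1-\frac1{2\kappa}$ the arctangent is read as $\pi/2$. Let $(c,\kappa)\in\tilde{\mathcal D}$. Then: 1. $F$ is a bijection from $I_\kappa$ onto $[0,\infty)$. Set $\eta(x)=F^{-1}(|x|)$, $\theta(x)=\frac c2\int_0^x\frac{\eta(y)}{1-\eta(y)}\,dy$ and $U=\sqrt{1-\eta}\,e^{i\theta}$ on $\mathbb R$. 2. $U\in\mathcal X(\mathbb R)$, and $U$ is a nontrivial weak solution of $(\mathrm{TW}(c,\kappa))$ with $\Gamma(U)=\{0\}$. 3. If $u\in\mathcal X(\mathbb R)$ is a nontrivial weak solution of $(\mathrm{TW}(c,\kappa))$ with $\Gamma(u)=\{0\}$, then there is $\varphi\in\mathbb R$ such that $u(x)=e^{i\varphi}U(x)$ for all $x\in\mathbb R$, and $\mathcal N(u)=\{0\}$. -/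

import Mathlib

open scoped ContDiff

namespace Cuspon

noncomputable section

/-! ### Function spaces and weak solutions -/

/-- `v` is the weak (distributional) derivative of `u` on the real line. -/
def IsWeakDeriv (u v : ℝ → ℂ) : Prop :=
  MeasureTheory.LocallyIntegrable u ∧ MeasureTheory.LocallyIntegrable v ∧
    ∀ φ : ℝ → ℝ, ContDiff ℝ ∞ φ → HasCompactSupport φ →
      ∫ x, ((deriv φ x : ℝ) : ℂ) * u x = -∫ x, ((φ x : ℝ) : ℂ) * v x

/-- The energy space `{u ∈ H¹_loc(ℝ) : 1 - |u|² ∈ L²(ℝ), u' ∈ L²(ℝ)}`. Its elements are represented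
by their continuous representatives, so that pointwise values of `u` make sense; `u` and `u'` are
then automatically locally square integrable. -/
def MemEnergySpace (u : ℝ → ℂ) : Prop :=
  Continuous u ∧
    MeasureTheory.MemLp (fun x => 1 - ‖u x‖ ^ 2) 2 MeasureTheory.volume ∧
    ∃ v : ℝ → ℂ, IsWeakDeriv u v ∧ MeasureTheory.MemLp v 2 MeasureTheory.volume

/-- `u` is a weak solution of `i c u' + u'' + u (1 - |u|²) + κ u (1 - |u|²)'' = 0` on the real line:
with `v = u'` (unique up to null sets) and `⟨z, w⟩ = Re z Re w + Im z Im w`,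
`∫ ⟨i c u' + u (1 - |u|²), φ⟩ - ⟨u', φ'⟩ + 2 κ ⟨u, u'⟩ ⟨u, φ⟩' = 0` for all `φ ∈ C_c^∞(ℝ; ℂ)`,
where `⟨u, φ⟩' = ⟨u', φ⟩ + ⟨u, φ'⟩`. -/
def IsWeakSolution (c κ : ℝ) (u : ℝ → ℂ) : Prop :=
  ∃ v : ℝ → ℂ, IsWeakDeriv u v ∧
    ∀ φ : ℝ → ℂ, ContDiff ℝ ∞ φ → HasCompactSupport φ →
      ∫ x, (inner ℝ (Complex.I * (c : ℂ) * v x + u x * ((1 - ‖u x‖ ^ 2 : ℝ) : ℂ)) (φ x)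
        - inner ℝ (v x) (deriv φ x)
        + 2 * κ * inner ℝ (u x) (v x) * (inner ℝ (v x) (φ x) + inner ℝ (u x) (deriv φ x))) = 0

/-- Trivial solutions: the constants of modulus one. -/
def IsTrivial (u : ℝ → ℂ) : Prop :=
  ∃ φ : ℝ, ∀ x, u x = Complex.exp (Complex.I * (φ : ℂ))

/-- The singular set `Γ(u) = {x : |u(x)|² = 1/(2κ)}`. -/
def singularSet (κ : ℝ) (u : ℝ → ℂ) : Set ℝ := {x | ‖u x‖ ^ 2 = 1 / (2 * κ)}

/-- The set `N(u)` of points where `u` is not differentiable in the classical sense. -/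
def nonDiffSet (u : ℝ → ℂ) : Set ℝ := {x | ¬ DifferentiableAt ℝ u x}

/-! ### Parameter regions -/

def regionD1 : Set (ℝ × ℝ) := {p | 0 ≤ p.1 ∧ p.1 < √2 ∧ 0 < p.2 ∧ p.2 < 1 / 2}

def regionD3 : Set (ℝ × ℝ) := {p | √2 < p.1 ∧ 1 / 2 < p.2}

def regionBminus : Set (ℝ × ℝ) := {p | p.1 = √2 ∧ 0 < p.2 ∧ p.2 < 1 / 2}

def regionBplus : Set (ℝ × ℝ) := {p | p.1 = √2 ∧ 1 / 2 < p.2}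

/-- The region `D̃ = D₁ ∪ D₃ ∪ B₋ ∪ B₊` of pairs `(c, κ)`. -/
def regionDtilde : Set (ℝ × ℝ) := regionD1 ∪ regionD3 ∪ regionBminus ∪ regionBplus

/-! ### The explicit profile -/

/-- The interval of values of the profile: `[1 - 1/(2κ), 0)` if `κ < 1/2` (antidark case), and
`(0, 1 - 1/(2κ)]` if `κ > 1/2` (dark case). -/
def profileRange (κ : ℝ) : Set ℝ :=
  if κ < 1 / 2 then Set.Ico (1 - 1 / (2 * κ)) 0 else Set.Ioc 0 (1 - 1 / (2 * κ))

/-- `atan √(a / b)`, with the convention `atan (+∞) = π/2` when the denominator `b` vanishes. -/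
def arctanSqrtDiv (a b : ℝ) : ℝ :=
  if b = 0 then Real.pi / 2 else Real.arctan (√(a / b))

/-- The function `f_{c,κ}` (also called `h_{c,κ}` when `κ > 1/2`), for `c ≠ √2`:
`2√κ atan(√κ √((2-c²-2y)/(1-2κ+2κy)))
  + 2√((1-2κ)/(2-c²)) atanh(√((2-c²)(1-2κ+2κy)/((1-2κ)(2-c²-2y)))) - π√κ`. -/
def cuspF (c κ y : ℝ) : ℝ :=
  2 * √κ * arctanSqrtDiv (κ * (2 - c ^ 2 - 2 * y)) (1 - 2 * κ + 2 * κ * y)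
    + 2 * √((1 - 2 * κ) / (2 - c ^ 2)) *
      Real.artanh (√((2 - c ^ 2) * (1 - 2 * κ + 2 * κ * y) /
        ((1 - 2 * κ) * (2 - c ^ 2 - 2 * y))))
    - Real.pi * √κ

/-- The function `g_κ` (also called `g̃_κ` when `κ > 1/2`), for `c = √2`:
`2√κ atan(√(-2κy/(1-2κ+2κy))) + √2 √(-(1-2κ+2κy)/y) - π√κ`. -/
def cuspG (κ y : ℝ) : ℝ :=
  2 * √κ * arctanSqrtDiv (-2 * κ * y) (1 - 2 * κ + 2 * κ * y)
    + √2 * √(-(1 - 2 * κ + 2 * κ * y) / y)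
    - Real.pi * √κ

/-- The function whose inverse is the profile on `[0, ∞)`. -/
def cuspFun (c κ : ℝ) : ℝ → ℝ := if c = √2 then cuspG κ else cuspF c κ

/-- The intensity profile `η_{c,κ}`: the inverse of `cuspFun c κ : profileRange κ → [0, ∞)`, extended
to an even function on the real line. -/
def cuspProfile (c κ x : ℝ) : ℝ := Function.invFunOn (cuspFun c κ) (profileRange κ) |x|

/-- The phase `θ_{c,κ}(x) = (c/2) ∫₀ˣ η/(1-η)`. -/
def cuspPhase (c κ x : ℝ) : ℝ :=
  c / 2 * ∫ y in (0 : ℝ)..x, cuspProfile c κ y / (1 - cuspProfile c κ y)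

/-- The cuspon `√(1-η_{c,κ}) e^{iθ_{c,κ}}`. -/
def cuspon (c κ : ℝ) (x : ℝ) : ℂ :=
  ((√(1 - cuspProfile c κ x) : ℝ) : ℂ) * Complex.exp (Complex.I * (cuspPhase c κ x : ℂ))

end

end Cuspon

/-!
Away from the singular set the equation reads `w' = -(i c v + (1 - |u|²) u + 2κ⟨u, v⟩ v)` with
`v = u'` and the flux `w = v - 2κ⟨u, v⟩ u`, which is an invertible linear function of `v` as long as
`2κ|u|² ≠ 1`. Finite energy kills the constants of its two first integrals, so that
`⟨i u, v⟩ = (c / 2) η` and `|v|² - 2κ⟨u, v⟩² = η² / 2` for `η = 1 - |u|²`. Eliminating the phase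
leaves the profile equation `η'² (1 - 2κ + 2κη) = η² (2 - c² - 2η)`.

In terms of `t = √((1 - 2κ + 2κη) / (2 - c² - 2η))`, which vanishes at the cusp, the decaying branch
`η' = -η / t` says that the explicit function `T(t)`, equal to `F(η)`, has derivative `1` along the
solution. As `T` is strictly monotone onto `ℝ`, the profile is `η(x) = F⁻¹(|x|)` on both sides of
the cusp. The modulus determines `⟨u, v⟩`, hence the logarithmic derivative `v / u`, so `u` is
unique up to a constant phase on each side, and the two phases agree by continuity at the cusp.
-/

open scoped Topology

namespace Cuspon

noncomputable section

open MeasureTheory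

/-! ### Integration by parts and the lemma of du Bois-Reymond -/

section Analysis

variable {E : Type*} [NormedAddCommGroup E] [NormedSpace ℝ E] [CompleteSpace E]

theorem integral_eq_zero_of_hasDerivAt_of_ne {f f' : ℝ → E} (a : ℝ) (hf : Continuous f)
    (hs : HasCompactSupport f) (hd : ∀ x, x ≠ a → HasDerivAt f (f' x) x) (hi : Integrable f') :
    ∫ x, f' x = 0 := by
  have h0 := hs.is_zero_at_infty
  rw [cocompact_eq_atBot_atTop, Filter.tendsto_sup] at h0
  have hright := integral_Ioi_of_hasDerivAt_of_tendsto (a := a) hf.continuousWithinAt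
    (fun x hx => hd x (ne_of_gt hx)) hi.integrableOn h0.2
  have hleft := integral_Iic_of_hasDerivAt_of_tendsto (a := a) hf.continuousWithinAt
    (fun x hx => hd x (ne_of_lt hx)) hi.integrableOn h0.1
  rw [← intervalIntegral.integral_Iic_add_Ioi (b := a) hi.integrableOn hi.integrableOn, hright,
    hleft]
  abel

theorem intervalIntegrable_of_locallyIntegrable {F : Type*} [NormedAddCommGroup F] {g : ℝ → F}
    (hg : LocallyIntegrable g) (a b : ℝ) : IntervalIntegrable g volume a b :=
  (hg.integrableOn_isCompact isCompact_uIcc).intervalIntegrable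

theorem exists_tsupport_subset_Ioc {φ : ℝ → ℝ} (hs : HasCompactSupport φ) :
    ∃ R, 0 < R ∧ tsupport φ ⊆ Set.Ioc (-R) R ∧ φ (-R) = 0 ∧ φ R = 0 := by
  obtain ⟨R, hR0, hR⟩ := hs.isCompact.isBounded.subset_ball_lt 0 0
  rw [Real.ball_eq_Ioo, zero_sub, zero_add] at hR
  exact ⟨R, hR0, hR.trans Set.Ioo_subset_Ioc_self,
    image_eq_zero_of_notMem_tsupport fun h => (hR h).1.false,
    image_eq_zero_of_notMem_tsupport fun h => (hR h).2.false⟩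

theorem integral_deriv_mul_primitive {g φ : ℝ → ℝ} (hg : LocallyIntegrable g)
    (hφ : ContDiff ℝ 1 φ) (hs : HasCompactSupport φ) :
    ∫ x, deriv φ x * (∫ t in (0 : ℝ)..x, g t) = -∫ x, φ x * g x := by
  obtain ⟨R, hR0, hR, hφl, hφr⟩ := exists_tsupport_subset_Ioc hs
  have hac : AbsolutelyContinuousOnInterval (fun x => ∫ t in (0 : ℝ)..x, g t) (-R) R :=
    (intervalIntegrable_of_locallyIntegrable hg _ _).absolutelyContinuousOnInterval_intervalIntegral
      (by rw [Set.uIcc_of_le (by linarith)]; constructor <;> linarith)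
  have hparts := hφ.contDiffOn.absolutelyContinuousOnInterval.integral_mul_deriv_eq_deriv_mul hac
  have hderiv : ∫ x in (-R)..R, φ x * deriv (fun x => ∫ t in (0 : ℝ)..x, g t) x
      = ∫ x in (-R)..R, φ x * g x := by
    refine intervalIntegral.integral_congr_ae ?_
    filter_upwards [LocallyIntegrable.ae_hasDerivAt_integral hg] with x hx _
    rw [(hx 0).deriv]
  rw [← intervalIntegral.integral_eq_integral_of_support_subset (a := -R) (b := R),
    ← intervalIntegral.integral_eq_integral_of_support_subset (a := -R) (b := R), ← hderiv,
    hparts, hφl, hφr]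
  · ring
  · exact fun x hx => hR (subset_tsupport _ (left_ne_zero_of_mul hx))
  · exact fun x hx => hR (support_deriv_subset (left_ne_zero_of_mul hx))

theorem integral_deriv_smul_primitive {g : ℝ → E} {φ : ℝ → ℝ} (hg : LocallyIntegrable g)
    (hφ : ContDiff ℝ 1 φ) (hs : HasCompactSupport φ) :
    ∫ x, deriv φ x • (∫ t in (0 : ℝ)..x, g t) = -∫ x, φ x • g x := by
  have hint := intervalIntegrable_of_locallyIntegrable hg
  have hprim : Continuous fun x => ∫ t in (0 : ℝ)..x, g t :=
    intervalIntegral.continuous_primitive hint 0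
  refine (SeparatingDual.eq_iff_forall_dual_eq (R := ℝ)).2 fun L => ?_
  rw [map_neg, ← L.integral_comp_comm (hg.integrable_smul_left_of_hasCompactSupport
      hφ.continuous hs), ← L.integral_comp_comm
      (hprim.locallyIntegrable.integrable_smul_left_of_hasCompactSupport
        (hφ.continuous_deriv le_rfl) hs.deriv)]
  simp only [map_smul, smul_eq_mul, ← L.intervalIntegral_comp_comm (hint 0 _)]
  refine integral_deriv_mul_primitive (fun x => ?_) hφ hs
  obtain ⟨s, hsx, hi⟩ := hg x
  exact ⟨s, hsx, L.integrable_comp hi⟩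

theorem exists_deriv_eq_of_integral_eq_zero {ψ : ℝ → ℝ} (hψ : ContDiff ℝ ∞ ψ)
    (hs : HasCompactSupport ψ) (h0 : ∫ x, ψ x = 0) :
    ∃ Ψ : ℝ → ℝ, ContDiff ℝ ∞ Ψ ∧ HasCompactSupport Ψ ∧ deriv Ψ = ψ := by
  obtain ⟨R, -, hR, -⟩ := exists_tsupport_subset_Ioc hs
  have hsub : Function.support ψ ⊆ Set.Ioc (-R) R := (subset_tsupport ψ).trans hR
  have hder : ∀ x, HasDerivAt (fun x => ∫ t in (-R)..x, ψ t) (ψ x) x := fun x =>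
    (hψ.continuous.integral_hasStrictDerivAt _ _).hasDerivAt
  have hderiv : deriv (fun x => ∫ t in (-R)..x, ψ t) = ψ := funext fun x => (hder x).deriv
  refine ⟨_, ?_, HasCompactSupport.intro (isCompact_Icc (a := -R) (b := R)) fun x hx => ?_, hderiv⟩
  · rw [contDiff_infty_iff_deriv, hderiv]
    exact ⟨fun x => (hder x).differentiableAt, hψ⟩
  · rcases lt_or_ge x (-R) with hl | hl
    · refine intervalIntegral.integral_zero_ae (Filter.Eventually.of_forall fun t ht => ?_)
      rw [Set.uIoc_of_ge hl.le] at ht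
      exact Function.notMem_support.1 fun h => ht.2.not_gt (hsub h).1
    · have hr : R < x := not_le.1 fun h => hx ⟨hl, h⟩
      rw [intervalIntegral.integral_eq_integral_of_support_subset
        (hsub.trans (Set.Ioc_subset_Ioc_right hr.le)), h0]

theorem ae_eq_const_of_integral_deriv_smul_eq_zero {h : ℝ → E} (hh : LocallyIntegrable h)
    (H : ∀ φ : ℝ → ℝ, ContDiff ℝ ∞ φ → HasCompactSupport φ → ∫ x, deriv φ x • h x = 0) :
    ∃ C, ∀ᵐ x, h x = C := by
  let χ : ContDiffBump (0 : ℝ) := ⟨1, 2, by norm_num, by norm_num⟩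
  have hχs : HasCompactSupport (χ.normed volume) := χ.hasCompactSupport_normed
  have hχd : ContDiff ℝ ∞ (χ.normed volume) := χ.contDiff_normed
  have hχi : Integrable (χ.normed volume) := hχd.continuous.integrable_of_hasCompactSupport hχs
  refine ⟨∫ x, χ.normed volume x • h x, ?_⟩
  set C := ∫ x, χ.normed volume x • h x
  suffices ∀ᵐ x, h x - C = 0 from this.mono fun x hx => sub_eq_zero.1 hx
  refine ae_eq_zero_of_integral_contDiff_smul_eq_zero (hh.sub (locallyIntegrable_const C))
    fun ψ hψ hψs => ?_
  have hψi : Integrable ψ := hψ.continuous.integrable_of_hasCompactSupport hψs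
  have hψh : Integrable fun x => ψ x • h x :=
    hh.integrable_smul_left_of_hasCompactSupport hψ.continuous hψs
  have hχh : Integrable fun x => χ.normed volume x • h x :=
    hh.integrable_smul_left_of_hasCompactSupport hχd.continuous hχs
  obtain ⟨Ψ, hΨ, hΨs, hΨ'⟩ := exists_deriv_eq_of_integral_eq_zero
    (ψ := fun x => ψ x - (∫ y, ψ y) * χ.normed volume x) (hψ.sub (contDiff_const.mul hχd))
    (hψs.sub hχs.mul_left) (by
      rw [integral_sub hψi (hχi.const_mul _), integral_const_mul, χ.integral_normed, mul_one,
        sub_self])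
  calc ∫ x, ψ x • (h x - C)
      = (∫ x, ψ x • h x) - (∫ y, ψ y) • C := by
        simp only [smul_sub]
        rw [integral_sub hψh (hψi.smul_const C), integral_smul_const]
    _ = ∫ x, deriv Ψ x • h x := by
        simp only [hΨ', sub_smul, mul_smul]
        rw [integral_sub hψh (hχh.fun_smul _), integral_smul]
    _ = 0 := H Ψ hΨ hΨs

theorem ae_eq_const_add_primitive {f g : ℝ → E} (hf : LocallyIntegrable f)
    (hg : LocallyIntegrable g)
    (H : ∀ φ : ℝ → ℝ, ContDiff ℝ ∞ φ → HasCompactSupport φ →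
      ∫ x, deriv φ x • f x = -∫ x, φ x • g x) :
    ∃ C, ∀ᵐ x, f x = C + ∫ t in (0 : ℝ)..x, g t := by
  have hprim : LocallyIntegrable fun x => ∫ t in (0 : ℝ)..x, g t :=
    (intervalIntegral.continuous_primitive
      (intervalIntegrable_of_locallyIntegrable hg) 0).locallyIntegrable
  obtain ⟨C, hC⟩ := ae_eq_const_of_integral_deriv_smul_eq_zero (hf.sub hprim) fun φ hφ hs => by
    have hφ1 : ContDiff ℝ 1 φ := hφ.of_le (by exact_mod_cast le_top)
    have hφ' := hφ1.continuous_deriv le_rfl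
    simp only [Pi.sub_apply, smul_sub]
    rw [integral_sub (hf.integrable_smul_left_of_hasCompactSupport hφ' hs.deriv)
      (hprim.integrable_smul_left_of_hasCompactSupport hφ' hs.deriv), H φ hφ hs,
      integral_deriv_smul_primitive hg hφ1 hs, sub_self]
  exact ⟨C, hC.mono fun x hx => sub_eq_iff_eq_add.1 hx⟩

end Analysis

/-! ### The travel time and its inverse -/

section TravelTime

variable {κ A t x : ℝ}

theorem hasDerivAt_artanh (hx : x ∈ Set.Ioo (-1 : ℝ) 1) :
    HasDerivAt Real.artanh (1 / (1 - x ^ 2)) x := by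
  have hplus : (0 : ℝ) < 1 + x := by linarith [hx.1]
  have hminus : (0 : ℝ) < 1 - x := by linarith [hx.2]
  have hlog := ((((hasDerivAt_id' x).const_add 1).fun_div ((hasDerivAt_id' x).const_sub 1)
    hminus.ne').log (by positivity)).const_mul (1 / 2)
  refine HasDerivAt.congr_of_eventuallyEq (hlog.congr_deriv ?_) ?_
  · rw [show 1 - x ^ 2 = (1 + x) * (1 - x) by ring]
    field_simp
    ring
  · filter_upwards [Ioo_mem_nhds hx.1 hx.2] with y hy
    exact Real.artanh_eq_half_log (Set.Ioo_subset_Icc_self hy)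

theorem artanh_neg_eq_neg (hx : x ∈ Set.Ioo (-1 : ℝ) 1) :
    Real.artanh (-x) = -Real.artanh x := by
  rw [← Real.tanh_artanh hx, ← Real.tanh_neg, Real.artanh_tanh, Real.artanh_tanh]

/-- The primitive of `1 / (1 - A t²)` vanishing at `0`, for `A ≥ 0`. -/
def artanhScaled (A t : ℝ) : ℝ := if A = 0 then t else Real.artanh (√A * t) / √A

/-- The set `A t² < 1` of indices, on which the travel time is defined. -/
def indexDomain (A : ℝ) : Set ℝ := {t | A * t ^ 2 < 1}

theorem one_sub_pos_of_mem_indexDomain (ht : t ∈ indexDomain A) : 0 < 1 - A * t ^ 2 :=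
  sub_pos.2 ht

theorem isOpen_indexDomain (A : ℝ) : IsOpen (indexDomain A) :=
  isOpen_lt (by fun_prop) continuous_const

theorem zero_mem_indexDomain (A : ℝ) : (0 : ℝ) ∈ indexDomain A := by simp [indexDomain]

theorem neg_mem_indexDomain (ht : t ∈ indexDomain A) : -t ∈ indexDomain A := by
  simpa [indexDomain] using ht

theorem ordConnected_indexDomain (hA : 0 ≤ A) : (indexDomain A).OrdConnected := by
  refine ⟨fun x (hx : A * x ^ 2 < 1) y (hy : A * y ^ 2 < 1) z hz => ?_⟩
  change A * z ^ 2 < 1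
  rcases le_max_iff.1 (abs_le_max_abs_abs hz.1 hz.2) with h | h
  · exact (mul_le_mul_of_nonneg_left (sq_le_sq.2 h) hA).trans_lt hx
  · exact (mul_le_mul_of_nonneg_left (sq_le_sq.2 h) hA).trans_lt hy

theorem sqrt_mul_mem_Ioo (hA : 0 ≤ A) (ht : t ∈ indexDomain A) : √A * t ∈ Set.Ioo (-1 : ℝ) 1 := by
  rw [Set.mem_Ioo, ← abs_lt, ← sq_lt_one_iff_abs_lt_one, mul_pow, Real.sq_sqrt hA]
  exact ht

theorem hasDerivAt_artanhScaled (hA : 0 ≤ A) (ht : t ∈ indexDomain A) :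
    HasDerivAt (artanhScaled A) (1 / (1 - A * t ^ 2)) t := by
  unfold artanhScaled
  rcases eq_or_ne A 0 with rfl | h
  · simpa using hasDerivAt_id' t
  · have : √A ≠ 0 := (Real.sqrt_ne_zero hA).2 h
    simp only [h, if_false]
    refine (((hasDerivAt_artanh (sqrt_mul_mem_Ioo hA ht)).comp t
      ((hasDerivAt_id' t).const_mul (√A))).div_const (√A)).congr_deriv ?_
    rw [mul_pow, Real.sq_sqrt hA]
    field_simp

theorem artanhScaled_neg (hA : 0 ≤ A) (ht : t ∈ indexDomain A) :
    artanhScaled A (-t) = -artanhScaled A t := by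
  unfold artanhScaled
  split_ifs
  · rfl
  · rw [mul_neg, artanh_neg_eq_neg (sqrt_mul_mem_Ioo hA ht), neg_div]

theorem exists_artanhScaled_eq (hA : 0 ≤ A) (s : ℝ) :
    ∃ t ∈ indexDomain A, artanhScaled A t = s := by
  unfold artanhScaled indexDomain
  rcases hA.eq_or_lt with rfl | h
  · exact ⟨s, by simp, by simp⟩
  · have hs : 0 < √A := Real.sqrt_pos.2 h
    refine ⟨Real.tanh (√A * s) / √A, ?_, ?_⟩
    · rw [Set.mem_ofPred_eq, div_pow, Real.sq_sqrt hA, mul_div_cancel₀ _ h.ne',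
        sq_lt_one_iff_abs_lt_one, abs_lt]
      exact ⟨Real.neg_one_lt_tanh _, Real.tanh_lt_one _⟩
    · rw [if_neg h.ne', mul_div_cancel₀ _ hs.ne', Real.artanh_tanh, mul_div_cancel_left₀ _ hs.ne']

/-- The position at which the cuspon profile takes the value of index `t`, where
`A = (2 - c²) / (1 - 2κ)`; negative indices correspond to negative positions. -/
def travelTime (κ A t : ℝ) : ℝ := 2 * (artanhScaled A t - √κ * Real.arctan (t / √κ))

theorem travelTime_neg (hA : 0 ≤ A) (ht : t ∈ indexDomain A) :
    travelTime κ A (-t) = -travelTime κ A t := by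
  unfold travelTime
  rw [artanhScaled_neg hA ht, neg_div, Real.arctan_neg]
  ring

theorem travelTime_zero (hA : 0 ≤ A) : travelTime κ A 0 = 0 := by
  have := travelTime_neg (κ := κ) hA (zero_mem_indexDomain A)
  rw [neg_zero] at this
  linarith

theorem hasDerivAt_sqrt_mul_arctan (hκ : 0 < κ) (t : ℝ) :
    HasDerivAt (fun t => √κ * Real.arctan (t / √κ)) (κ / (κ + t ^ 2)) t := by
  have : 0 < √κ := Real.sqrt_pos.2 hκ
  refine (((hasDerivAt_id' t).div_const (√κ)).arctan.const_mul (√κ)).congr_deriv ?_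
  rw [div_pow, Real.sq_sqrt hκ.le]
  field_simp

theorem hasDerivAt_travelTime (hκ : 0 < κ) (hA : 0 ≤ A) (ht : t ∈ indexDomain A) :
    HasDerivAt (travelTime κ A) (2 * t ^ 2 * (1 + A * κ) / ((κ + t ^ 2) * (1 - A * t ^ 2))) t := by
  refine (((hasDerivAt_artanhScaled hA ht).sub (hasDerivAt_sqrt_mul_arctan hκ t)).const_mul
    2).congr_deriv ?_
  have : 1 - A * t ^ 2 ≠ 0 := (one_sub_pos_of_mem_indexDomain ht).ne'
  have : κ + t ^ 2 ≠ 0 := by positivity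
  field_simp
  ring

theorem continuousOn_travelTime (hκ : 0 < κ) (hA : 0 ≤ A) :
    ContinuousOn (travelTime κ A) (indexDomain A) :=
  fun _ ht => (hasDerivAt_travelTime hκ hA ht).continuousAt.continuousWithinAt

theorem strictMonoOn_travelTime (hκ : 0 < κ) (hA : 0 ≤ A) :
    StrictMonoOn (travelTime κ A) (indexDomain A) := by
  have hpos : ∀ t ∈ indexDomain A, t ≠ 0 → 0 < deriv (travelTime κ A) t := fun t ht ht0 => by
    have := one_sub_pos_of_mem_indexDomain ht
    rw [(hasDerivAt_travelTime hκ hA ht).deriv]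
    positivity
  have hconvex : Convex ℝ (indexDomain A) := (ordConnected_indexDomain hA).convex
  have hcont := continuousOn_travelTime hκ hA
  have hleft : StrictMonoOn (travelTime κ A) (indexDomain A ∩ Set.Iic 0) := by
    refine strictMonoOn_of_deriv_pos (hconvex.inter (convex_Iic 0))
      (hcont.mono Set.inter_subset_left) fun t ht => ?_
    rw [interior_inter, (isOpen_indexDomain A).interior_eq, interior_Iic] at ht
    exact hpos t ht.1 (ne_of_lt ht.2)
  have hright : StrictMonoOn (travelTime κ A) (indexDomain A ∩ Set.Ici 0) := by
    refine strictMonoOn_of_deriv_pos (hconvex.inter (convex_Ici 0))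
      (hcont.mono Set.inter_subset_left) fun t ht => ?_
    rw [interior_inter, (isOpen_indexDomain A).interior_eq, interior_Ici] at ht
    exact hpos t ht.1 (ne_of_gt ht.2)
  have h0 := zero_mem_indexDomain A
  have hunion := hleft.union hright (c := 0) ⟨⟨h0, Set.self_mem_Iic⟩, fun t ht => ht.2⟩
    ⟨⟨h0, Set.self_mem_Ici⟩, fun t ht => ht.2⟩
  rwa [← Set.inter_union_distrib_left, Set.Iic_union_Ici, Set.inter_univ] at hunion

theorem exists_travelTime_eq (hκ : 0 < κ) (hA : 0 ≤ A) (x : ℝ) :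
    ∃ t ∈ indexDomain A, travelTime κ A t = x := by
  obtain ⟨t₁, h₁, e₁⟩ := exists_artanhScaled_eq hA (x / 2 - √κ * (Real.pi / 2))
  obtain ⟨t₂, h₂, e₂⟩ := exists_artanhScaled_eq hA (x / 2 + √κ * (Real.pi / 2))
  have hlower := mul_le_mul_of_nonneg_left (Real.neg_pi_div_two_lt_arctan (t₁ / √κ)).le
    (Real.sqrt_nonneg κ)
  have hupper := mul_le_mul_of_nonneg_left (Real.arctan_lt_pi_div_two (t₂ / √κ)).le
    (Real.sqrt_nonneg κ)
  refine (ordConnected_indexDomain hA).isPreconnected.intermediate_value h₁ h₂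
    (continuousOn_travelTime hκ hA) ⟨?_, ?_⟩
  · rw [travelTime, e₁]
    linarith
  · rw [travelTime, e₂]
    linarith

theorem travelTime_nonneg (hκ : 0 < κ) (hA : 0 ≤ A) (ht : t ∈ indexDomain A) (h0 : 0 ≤ t) :
    0 ≤ travelTime κ A t := by
  rw [← travelTime_zero (κ := κ) hA]
  exact (strictMonoOn_travelTime hκ hA).monotoneOn (zero_mem_indexDomain A) ht h0

/-- The inverse of the travel time (for `κ > 0` and `A ≥ 0`): the index of the value taken by the
profile at the position `x`. -/
def travelIndex (κ A : ℝ) : ℝ → ℝ := Function.invFunOn (travelTime κ A) (indexDomain A)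

theorem travelIndex_mem (hκ : 0 < κ) (hA : 0 ≤ A) (x : ℝ) : travelIndex κ A x ∈ indexDomain A :=
  Function.invFunOn_mem (exists_travelTime_eq hκ hA x)

theorem travelTime_travelIndex (hκ : 0 < κ) (hA : 0 ≤ A) (x : ℝ) :
    travelTime κ A (travelIndex κ A x) = x :=
  Function.invFunOn_eq (exists_travelTime_eq hκ hA x)

theorem travelIndex_travelTime (hκ : 0 < κ) (hA : 0 ≤ A) (ht : t ∈ indexDomain A) :
    travelIndex κ A (travelTime κ A t) = t :=
  (strictMonoOn_travelTime hκ hA).injOn.leftInvOn_invFunOn ht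

theorem travelIndex_zero (hκ : 0 < κ) (hA : 0 ≤ A) : travelIndex κ A 0 = 0 := by
  simpa only [travelTime_zero hA] using travelIndex_travelTime hκ hA (zero_mem_indexDomain A)

theorem travelIndex_neg (hκ : 0 < κ) (hA : 0 ≤ A) (x : ℝ) :
    travelIndex κ A (-x) = -travelIndex κ A x := by
  have hx := travelIndex_mem hκ hA x
  simpa only [travelTime_neg hA hx, travelTime_travelIndex hκ hA] using
    travelIndex_travelTime hκ hA (neg_mem_indexDomain hx)

theorem strictMono_travelIndex (hκ : 0 < κ) (hA : 0 ≤ A) : StrictMono (travelIndex κ A) := by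
  intro x y hxy
  rw [← (strictMonoOn_travelTime hκ hA).lt_iff_lt (travelIndex_mem hκ hA x)
    (travelIndex_mem hκ hA y), travelTime_travelIndex hκ hA, travelTime_travelIndex hκ hA]
  exact hxy

theorem travelIndex_pos (hκ : 0 < κ) (hA : 0 ≤ A) (hx : 0 < x) : 0 < travelIndex κ A x := by
  simpa only [travelIndex_zero hκ hA] using strictMono_travelIndex hκ hA hx

theorem travelIndex_nonneg (hκ : 0 < κ) (hA : 0 ≤ A) (hx : 0 ≤ x) : 0 ≤ travelIndex κ A x := by
  simpa only [travelIndex_zero hκ hA] using (strictMono_travelIndex hκ hA).monotone hx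

theorem travelIndex_ne_zero (hκ : 0 < κ) (hA : 0 ≤ A) (hx : x ≠ 0) : travelIndex κ A x ≠ 0 := by
  simpa only [travelIndex_zero hκ hA] using (strictMono_travelIndex hκ hA).injective.ne hx

theorem continuous_travelIndex (hκ : 0 < κ) (hA : 0 ≤ A) : Continuous (travelIndex κ A) := by
  refine continuous_iff_continuousAt.2 fun x => continuousAt_of_monotoneOn_of_image_mem_nhds
    (s := Set.univ) ((strictMono_travelIndex hκ hA).monotone.monotoneOn _) Filter.univ_mem ?_
  refine Filter.mem_of_superset ((isOpen_indexDomain A).mem_nhds (travelIndex_mem hκ hA x)) ?_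
  exact fun t ht => ⟨travelTime κ A t, trivial, travelIndex_travelTime hκ hA ht⟩

theorem hasDerivAt_travelIndex (hκ : 0 < κ) (hA : 0 ≤ A) (hx : x ≠ 0) :
    HasDerivAt (travelIndex κ A) ((κ + travelIndex κ A x ^ 2) * (1 - A * travelIndex κ A x ^ 2) /
      (2 * travelIndex κ A x ^ 2 * (1 + A * κ))) x := by
  have := travelIndex_ne_zero hκ hA hx
  have hmem := travelIndex_mem hκ hA x
  have := one_sub_pos_of_mem_indexDomain hmem
  rw [← inv_div]
  exact HasDerivAt.of_local_left_inverse (continuous_travelIndex hκ hA).continuousAt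
    (hasDerivAt_travelTime hκ hA hmem) (by positivity)
    (Filter.Eventually.of_forall (travelTime_travelIndex hκ hA))

end TravelTime

/-! ### The profile as a function of the index -/

section ProfileValue

variable {κ A t y : ℝ}

/-- The value of the profile at index `t`, where `A = (2 - c²) / (1 - 2κ)`. -/
def profileValue (κ A t : ℝ) : ℝ := (1 - 2 * κ) * (A * t ^ 2 - 1) / (2 * (κ + t ^ 2))

theorem profileValue_neg (κ A t : ℝ) : profileValue κ A (-t) = profileValue κ A t := by
  simp only [profileValue, even_two.neg_pow]

theorem profileValue_denom (hκ : 0 < κ) (A t : ℝ) :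
    1 - 2 * κ + 2 * κ * profileValue κ A t
      = t ^ 2 * ((1 - 2 * κ) * (1 + A * κ) / (κ + t ^ 2)) := by
  have : κ + t ^ 2 ≠ 0 := by positivity
  unfold profileValue
  field_simp
  ring

theorem profileValue_numer (hκ : 0 < κ) (A t : ℝ) :
    (1 - 2 * κ) * A - 2 * profileValue κ A t = (1 - 2 * κ) * (1 + A * κ) / (κ + t ^ 2) := by
  have : κ + t ^ 2 ≠ 0 := by positivity
  unfold profileValue
  field_simp
  ring

theorem hasDerivAt_profileValue (hκ : 0 < κ) (A t : ℝ) :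
    HasDerivAt (profileValue κ A) ((1 - 2 * κ) * (1 + A * κ) * t / (κ + t ^ 2) ^ 2) t := by
  have : κ + t ^ 2 ≠ 0 := by positivity
  refine (((((hasDerivAt_pow 2 t).const_mul A).sub_const 1).const_mul (1 - 2 * κ)).div
    (((hasDerivAt_pow 2 t).const_add κ).const_mul 2) (by positivity)).congr_deriv ?_
  field_simp
  push_cast
  ring

theorem one_sub_two_mul_ne_zero (hκ : κ ≠ 1 / 2) : 1 - 2 * κ ≠ 0 := fun h => hκ (by linarith)

theorem mem_profileRange_iff (hκ : 0 < κ) (hκ' : κ ≠ 1 / 2) :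
    y ∈ profileRange κ ↔ (1 - 2 * κ) * y < 0 ∧ 0 ≤ (1 - 2 * κ) * (1 - 2 * κ + 2 * κ * y) := by
  have hendpoint : 1 - 2 * κ + 2 * κ * y = 2 * κ * (y - (1 - 1 / (2 * κ))) := by
    field_simp
    ring
  have h2κ : 0 < 2 * κ := by positivity
  rw [hendpoint]
  unfold profileRange
  split_ifs with h
  · have hpos : 0 < 1 - 2 * κ := by linarith
    rw [Set.mem_Ico, mul_nonneg_iff_of_pos_left hpos, mul_nonneg_iff_of_pos_left h2κ, sub_nonneg,
      mul_neg_iff, and_comm]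
    simp only [hpos, hpos.not_gt, true_and, false_and, or_false]
  · have hneg : 1 - 2 * κ < 0 := lt_of_le_of_ne (by linarith) (one_sub_two_mul_ne_zero hκ')
    rw [Set.mem_Ioc, ← neg_mul_neg (1 - 2 * κ) (_ * _),
      mul_nonneg_iff_of_pos_left (neg_pos.2 hneg), ← mul_neg, mul_nonneg_iff_of_pos_left h2κ,
      neg_sub, sub_nonneg, mul_neg_iff]
    simp only [hneg, hneg.not_gt, true_and, false_and, false_or]

theorem profileValue_mem (hκ : 0 < κ) (hκ' : κ ≠ 1 / 2) (hA : 0 ≤ A) (ht : t ∈ indexDomain A) :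
    profileValue κ A t ∈ profileRange κ := by
  have := one_sub_pos_of_mem_indexDomain ht
  have : 1 - 2 * κ ≠ 0 := one_sub_two_mul_ne_zero hκ'
  rw [mem_profileRange_iff hκ hκ', profileValue_denom hκ]
  constructor
  · calc (1 - 2 * κ) * profileValue κ A t
        = -((1 - 2 * κ) ^ 2 * (1 - A * t ^ 2) / (2 * (κ + t ^ 2))) := by
          unfold profileValue
          ring
      _ < 0 := neg_neg_of_pos (by positivity)
  · calc (0 : ℝ) ≤ (1 - 2 * κ) ^ 2 * t ^ 2 * (1 + A * κ) / (κ + t ^ 2) := by positivity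
      _ = (1 - 2 * κ) * (t ^ 2 * ((1 - 2 * κ) * (1 + A * κ) / (κ + t ^ 2))) := by ring

/-- The nonnegative index at which the profile takes the value `y`. -/
def indexOfValue (κ A y : ℝ) : ℝ := √((1 - 2 * κ + 2 * κ * y) / ((1 - 2 * κ) * A - 2 * y))

theorem indexOfValue_numer_pos (hA : 0 ≤ A) (hy : (1 - 2 * κ) * y < 0) :
    0 < (1 - 2 * κ) * ((1 - 2 * κ) * A - 2 * y) := by
  linarith [mul_nonneg (sq_nonneg (1 - 2 * κ)) hA]

theorem indexOfValue_sq_mul (hκ : 0 < κ) (hκ' : κ ≠ 1 / 2) (hA : 0 ≤ A)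
    (hy : y ∈ profileRange κ) :
    indexOfValue κ A y ^ 2 * ((1 - 2 * κ) * A - 2 * y) = 1 - 2 * κ + 2 * κ * y := by
  rw [mem_profileRange_iff hκ hκ'] at hy
  have hpos := indexOfValue_numer_pos hA hy.1
  rw [indexOfValue, Real.sq_sqrt, div_mul_cancel₀ _ (right_ne_zero_of_mul hpos.ne')]
  rw [← mul_div_mul_left _ _ (one_sub_two_mul_ne_zero hκ')]
  exact div_nonneg hy.2 hpos.le

theorem indexOfValue_mem (hκ : 0 < κ) (hκ' : κ ≠ 1 / 2) (hA : 0 ≤ A) (hy : y ∈ profileRange κ) :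
    indexOfValue κ A y ∈ indexDomain A := by
  have hsq := indexOfValue_sq_mul hκ hκ' hA hy
  rw [mem_profileRange_iff hκ hκ'] at hy
  have hpos := indexOfValue_numer_pos hA hy.1
  have hprod : (1 - 2 * κ) * ((1 - 2 * κ) * A - 2 * y) * (A * indexOfValue κ A y ^ 2 - 1)
      = 2 * (1 + A * κ) * ((1 - 2 * κ) * y) := by
    linear_combination A * (1 - 2 * κ) * hsq
  have hneg : 2 * (1 + A * κ) * ((1 - 2 * κ) * y) < 0 := mul_neg_of_pos_of_neg (by positivity) hy.1
  rw [← hprod] at hneg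
  exact sub_neg.1 (neg_of_mul_neg_right hneg hpos.le)

theorem profileValue_indexOfValue (hκ : 0 < κ) (hκ' : κ ≠ 1 / 2) (hA : 0 ≤ A)
    (hy : y ∈ profileRange κ) : profileValue κ A (indexOfValue κ A y) = y := by
  rw [profileValue, div_eq_iff (by positivity)]
  linear_combination indexOfValue_sq_mul hκ hκ' hA hy

end ProfileValue

section CuspFun

variable {c κ A t : ℝ}

theorem arctanSqrtDiv_mul_right {r : ℝ} (hκ : 0 < κ) (ht : 0 ≤ t) (hr : r ≠ 0) :
    arctanSqrtDiv (κ * r) (t ^ 2 * r) = Real.pi / 2 - Real.arctan (t / √κ) := by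
  unfold arctanSqrtDiv
  rcases ht.eq_or_lt with rfl | h
  · simp
  · rw [if_neg (by positivity), mul_div_mul_right _ _ hr, Real.sqrt_div hκ.le, Real.sqrt_sq ht,
      ← Real.arctan_inv_of_pos (by positivity), inv_div]

theorem cuspG_profileValue (hκ : 0 < κ) (hκ' : κ ≠ 1 / 2) (ht : 0 ≤ t) :
    cuspG κ (profileValue κ 0 t) = travelTime κ 0 t := by
  have : κ + t ^ 2 ≠ 0 := by positivity
  have hdenom := profileValue_denom hκ 0 t
  have hnumer := profileValue_numer hκ 0 t
  set r := (1 - 2 * κ) * (1 + 0 * κ) / (κ + t ^ 2) with hr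
  have hr0 : r ≠ 0 := by
    rw [hr, zero_mul, add_zero, mul_one]
    exact div_ne_zero (one_sub_two_mul_ne_zero hκ') this
  have hvalue : profileValue κ 0 t = -(r / 2) := by linarith
  rw [cuspG, travelTime, artanhScaled, if_pos rfl, hdenom, hvalue,
    show -2 * κ * -(r / 2) = κ * r by ring, arctanSqrtDiv_mul_right hκ ht hr0,
    show -(t ^ 2 * r) / -(r / 2) = 2 * t ^ 2 by field_simp, Real.sqrt_mul (by norm_num),
    Real.sqrt_sq ht, ← mul_assoc, Real.mul_self_sqrt (by norm_num)]
  ring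

theorem cuspF_profileValue (hκ : 0 < κ) (hκ' : κ ≠ 1 / 2) (hA : 0 < A)
    (hc : 2 - c ^ 2 = (1 - 2 * κ) * A) (ht : 0 ≤ t) :
    cuspF c κ (profileValue κ A t) = travelTime κ A t := by
  have hκ'' := one_sub_two_mul_ne_zero hκ'
  have hdenom := profileValue_denom hκ A t
  have hnumer := profileValue_numer hκ A t
  set r := (1 - 2 * κ) * (1 + A * κ) / (κ + t ^ 2) with hr
  have hr0 : r ≠ 0 := by
    rw [hr]
    exact div_ne_zero (mul_ne_zero hκ'' (by positivity)) (by positivity)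
  rw [cuspF, travelTime, artanhScaled, if_neg hA.ne', hc, hdenom, hnumer,
    arctanSqrtDiv_mul_right hκ ht hr0,
    show (1 - 2 * κ) / ((1 - 2 * κ) * A) = A⁻¹ by field_simp,
    show (1 - 2 * κ) * A * (t ^ 2 * r) / ((1 - 2 * κ) * r) = A * t ^ 2 by field_simp,
    Real.sqrt_inv, Real.sqrt_mul hA.le, Real.sqrt_sq ht]
  ring

/-- The value of the parameter `A` of the travel time for the speed `c`. -/
def speedRatio (c κ : ℝ) : ℝ := (2 - c ^ 2) / (1 - 2 * κ)

/-- The index `t` of the value `profileValue κ A t` of the cuspon profile at the point `x`. -/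
def cuspIndex (c κ x : ℝ) : ℝ := travelIndex κ (speedRatio c κ) x

/-- The parameters `(c, κ)` for which the explicit formulas define a cuspon: those of `D̃`, and
their reflections under `c ↦ -c`. The speed `-√2` is left out because there `cuspFun` is given by
`cuspF`, whose terms divide by `2 - c² = 0`. -/
structure IsCuspParam (c κ : ℝ) : Prop where
  kappa_pos : 0 < κ
  kappa_ne_half : κ ≠ 1 / 2
  speed_ne_neg_sqrt_two : c ≠ -√2
  speedRatio_nonneg : 0 ≤ speedRatio c κ

theorem isCuspParam_of_mem_regionDtilde (h : (c, κ) ∈ regionDtilde) : IsCuspParam c κ := by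
  have hsqrt : 0 < √(2 : ℝ) := by positivity
  have hsq : √2 ^ 2 = (2 : ℝ) := Real.sq_sqrt (by norm_num)
  suffices 0 ≤ c ∧ 0 < κ ∧ κ ≠ 1 / 2 ∧ 0 ≤ (2 - c ^ 2) / (1 - 2 * κ) from
    ⟨this.2.1, this.2.2.1, by linarith, this.2.2.2⟩
  rcases h with ((⟨hc0, hc, hκ0, hκ⟩ | ⟨hc, hκ⟩) | ⟨hc, hκ0, hκ⟩) | ⟨hc, hκ⟩ <;> dsimp only at *
  · exact ⟨hc0, hκ0, hκ.ne, div_nonneg (by nlinarith) (by linarith)⟩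
  · exact ⟨by linarith, by linarith, hκ.ne', div_nonneg_of_nonpos (by nlinarith) (by linarith)⟩
  · exact ⟨by linarith, hκ0, hκ.ne, by simp [hc, hsq]⟩
  · exact ⟨by linarith, by linarith, hκ.ne', by simp [hc, hsq]⟩

namespace IsCuspParam

theorem two_sub_speed_sq (h : IsCuspParam c κ) :
    2 - c ^ 2 = (1 - 2 * κ) * speedRatio c κ := by
  rw [speedRatio, mul_div_cancel₀ _ (one_sub_two_mul_ne_zero h.kappa_ne_half)]

theorem speed_eq_sqrt_two_iff (h : IsCuspParam c κ) : c = √2 ↔ speedRatio c κ = 0 := by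
  rw [speedRatio, div_eq_zero_iff, or_iff_left (one_sub_two_mul_ne_zero h.kappa_ne_half),
    sub_eq_zero, eq_comm (a := (2 : ℝ)), ← Real.sq_sqrt (show (0 : ℝ) ≤ 2 by norm_num),
    sq_eq_sq_iff_eq_or_eq_neg, Real.sq_sqrt (by norm_num), or_iff_left h.speed_ne_neg_sqrt_two]

theorem cuspFun_profileValue (h : IsCuspParam c κ) (ht : 0 ≤ t) :
    cuspFun c κ (profileValue κ (speedRatio c κ) t) = travelTime κ (speedRatio c κ) t := by
  rcases h.speedRatio_nonneg.eq_or_lt' with hA | hA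
  · rw [cuspFun, if_pos (h.speed_eq_sqrt_two_iff.2 hA), hA,
      cuspG_profileValue h.kappa_pos h.kappa_ne_half ht]
  · rw [cuspFun, if_neg (mt h.speed_eq_sqrt_two_iff.1 hA.ne'),
      cuspF_profileValue h.kappa_pos h.kappa_ne_half hA h.two_sub_speed_sq ht]

theorem bijOn_cuspFun (h : IsCuspParam c κ) :
    Set.BijOn (cuspFun c κ) (profileRange κ) (Set.Ici 0) := by
  have hκ := h.kappa_pos
  have hA := h.speedRatio_nonneg
  have hindex : ∀ y ∈ profileRange κ, ∃ t ∈ indexDomain (speedRatio c κ), 0 ≤ t ∧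
      profileValue κ (speedRatio c κ) t = y := fun y hy =>
    ⟨_, indexOfValue_mem hκ h.kappa_ne_half hA hy, Real.sqrt_nonneg _,
      profileValue_indexOfValue hκ h.kappa_ne_half hA hy⟩
  refine ⟨fun y hy => ?_, fun y hy z hz hyz => ?_, fun x hx => ?_⟩
  · obtain ⟨t, ht, ht0, rfl⟩ := hindex y hy
    rw [h.cuspFun_profileValue ht0]
    exact travelTime_nonneg hκ hA ht ht0
  · obtain ⟨t, ht, ht0, rfl⟩ := hindex y hy
    obtain ⟨s, hs, hs0, rfl⟩ := hindex z hz
    rw [h.cuspFun_profileValue ht0, h.cuspFun_profileValue hs0] at hyz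
    rw [(strictMonoOn_travelTime hκ hA).injOn ht hs hyz]
  · refine ⟨_, profileValue_mem hκ h.kappa_ne_half hA (travelIndex_mem hκ hA x), ?_⟩
    rw [h.cuspFun_profileValue (travelIndex_nonneg hκ hA hx), travelTime_travelIndex hκ hA]

theorem cuspProfile_eq (h : IsCuspParam c κ) (x : ℝ) :
    cuspProfile c κ x = profileValue κ (speedRatio c κ) (cuspIndex c κ x) := by
  have hκ := h.kappa_pos
  have hA := h.speedRatio_nonneg
  have heven : profileValue κ (speedRatio c κ) (cuspIndex c κ |x|)
      = profileValue κ (speedRatio c κ) (cuspIndex c κ x) := by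
    rcases abs_choice x with hx | hx <;> rw [hx]
    rw [cuspIndex, travelIndex_neg hκ hA, profileValue_neg, cuspIndex]
  have hinv := h.bijOn_cuspFun.injOn.leftInvOn_invFunOn
    (profileValue_mem hκ h.kappa_ne_half hA (travelIndex_mem hκ hA |x|))
  rwa [h.cuspFun_profileValue (travelIndex_nonneg hκ hA (abs_nonneg x)),
    travelTime_travelIndex hκ hA, ← cuspIndex, heven] at hinv

end IsCuspParam

end CuspFun

/-! ### Weak derivatives -/

section WeakDeriv

variable {u v : ℝ → ℂ}

theorem isWeakDeriv_iff_smul : IsWeakDeriv u v ↔ LocallyIntegrable u ∧ LocallyIntegrable v ∧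
    ∀ φ : ℝ → ℝ, ContDiff ℝ ∞ φ → HasCompactSupport φ →
      ∫ x, deriv φ x • u x = -∫ x, φ x • v x := by
  simp only [IsWeakDeriv, Complex.real_smul]

theorem isWeakDeriv_of_hasDerivAt_of_ne (a : ℝ) (hu : Continuous u) (hv : LocallyIntegrable v)
    (hd : ∀ x, x ≠ a → HasDerivAt u (v x) x) : IsWeakDeriv u v := by
  refine isWeakDeriv_iff_smul.2 ⟨hu.locallyIntegrable, hv, fun φ hφ hs => ?_⟩
  have hleft : Integrable fun x => deriv φ x • u x :=
    hu.locallyIntegrable.integrable_smul_left_of_hasCompactSupport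
      (hφ.continuous_deriv (by simp)) hs.deriv
  have hright : Integrable fun x => φ x • v x :=
    hv.integrable_smul_left_of_hasCompactSupport hφ.continuous hs
  rw [← add_eq_zero_iff_eq_neg, ← integral_add hleft hright]
  refine integral_eq_zero_of_hasDerivAt_of_ne a (hφ.continuous.smul hu) hs.smul_right
    (fun x hx => ?_) (hleft.add hright)
  rw [add_comm]
  exact (hφ.differentiable (by simp) x).hasDerivAt.smul (hd x hx)

theorem IsWeakDeriv.congr_ae {u' v' : ℝ → ℂ} (h : IsWeakDeriv u v) (hu : u =ᵐ[volume] u')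
    (hv : v =ᵐ[volume] v') : IsWeakDeriv u' v' := by
  have hloc : ∀ {f g : ℝ → ℂ}, LocallyIntegrable f → f =ᵐ[volume] g → LocallyIntegrable g :=
    fun hf hfg => hf.mono (hf.aestronglyMeasurable.congr hfg) (hfg.mono fun _ h => by rw [h])
  refine ⟨hloc h.1 hu, hloc h.2.1 hv, fun φ hφ hs => ?_⟩
  rw [integral_congr_ae (hu.mono fun x hx => by simp only [hx] :
      (fun x => ((deriv φ x : ℝ) : ℂ) * u' x) =ᵐ[volume] fun x => ((deriv φ x : ℝ) : ℂ) * u x),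
    integral_congr_ae (hv.mono fun x hx => by simp only [hx] :
      (fun x => ((φ x : ℝ) : ℂ) * v' x) =ᵐ[volume] fun x => ((φ x : ℝ) : ℂ) * v x)]
  exact h.2.2 φ hφ hs

theorem IsWeakDeriv.ae_eq {v' : ℝ → ℂ} (hv : IsWeakDeriv u v) (hv' : IsWeakDeriv u v') :
    v =ᵐ[volume] v' := by
  rw [isWeakDeriv_iff_smul] at hv hv'
  have hzero : ∀ᵐ x, v x - v' x = 0 := by
    refine ae_eq_zero_of_integral_contDiff_smul_eq_zero (hv.2.1.sub hv'.2.1) fun φ hφ hs => ?_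
    simp only [smul_sub]
    rw [integral_sub (hv.2.1.integrable_smul_left_of_hasCompactSupport hφ.continuous hs)
        (hv'.2.1.integrable_smul_left_of_hasCompactSupport hφ.continuous hs),
      neg_injective ((hv.2.2 φ hφ hs).symm.trans (hv'.2.2 φ hφ hs)), sub_self]
  exact hzero.mono fun x => sub_eq_zero.1

theorem IsWeakDeriv.exists_ae_eq_primitive (h : IsWeakDeriv u v) :
    ∃ C, ∀ᵐ x, u x = C + ∫ t in (0 : ℝ)..x, v t :=
  have h := isWeakDeriv_iff_smul.1 h
  ae_eq_const_add_primitive h.1 h.2.1 h.2.2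

theorem IsWeakDeriv.continuous_primitive (h : IsWeakDeriv u v) :
    Continuous fun x => ∫ t in (0 : ℝ)..x, v t :=
  intervalIntegral.continuous_primitive (intervalIntegrable_of_locallyIntegrable h.2.1) 0

theorem IsWeakDeriv.hasDerivAt (h : IsWeakDeriv u v) (hu : Continuous u) {x : ℝ}
    (hx : ContinuousAt v x) : HasDerivAt u (v x) x := by
  obtain ⟨C, hC⟩ := h.exists_ae_eq_primitive
  rw [(hu.ae_eq_iff_eq volume (continuous_const.add h.continuous_primitive)).1 hC]
  exact (intervalIntegral.integral_hasDerivAt_right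
    (intervalIntegrable_of_locallyIntegrable h.2.1 0 x)
    h.2.1.aestronglyMeasurable.stronglyMeasurableAtFilter hx).const_add C

theorem integrable_inner_of_hasCompactSupport {φ : ℝ → ℂ} (hu : LocallyIntegrable u)
    (hφ : Continuous φ) (hs : HasCompactSupport φ) : Integrable fun x => inner ℝ (u x) (φ x) := by
  refine (hu.integrable_smul_left_of_hasCompactSupport hφ.norm hs.norm).norm.mono'
    (hu.aestronglyMeasurable.inner hφ.aestronglyMeasurable) (.of_forall fun x => ?_)
  rw [norm_smul, norm_norm, mul_comm]
  exact norm_inner_le_norm _ _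

theorem integrable_clm_mul_clm {φ : ℝ → ℂ} (L : ℂ →L[ℝ] ℝ) (hu : LocallyIntegrable u)
    (hφ : Continuous φ) (hs : HasCompactSupport φ) : Integrable fun x => L (φ x) * L (u x) := by
  simpa only [map_smul, smul_eq_mul, Function.comp_apply] using L.integrable_comp
    (hu.integrable_smul_left_of_hasCompactSupport (L.continuous.comp hφ) (hs.comp_left L.map_zero))

theorem IsWeakDeriv.integral_clm_deriv_mul {φ : ℝ → ℂ} (h : IsWeakDeriv u v) (L : ℂ →L[ℝ] ℝ)
    (hφ : ContDiff ℝ ∞ φ) (hs : HasCompactSupport φ) :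
    ∫ x, L (deriv φ x) * L (u x) = -∫ x, L (φ x) * L (v x) := by
  rw [isWeakDeriv_iff_smul] at h
  have hLφ : ContDiff ℝ ∞ fun x => L (φ x) := L.contDiff.comp hφ
  have hLs : HasCompactSupport fun x => L (φ x) := hs.comp_left L.map_zero
  have hderiv : deriv (fun x => L (φ x)) = fun x => L (deriv φ x) := funext fun x =>
    (L.hasFDerivAt.comp_hasDerivAt x (hφ.differentiable (by simp) x).hasDerivAt).deriv
  have htest := congrArg L (h.2.2 _ hLφ hLs)
  rw [map_neg, ← L.integral_comp_comm (h.1.integrable_smul_left_of_hasCompactSupport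
      (hLφ.continuous_deriv (by simp)) hLs.deriv),
    ← L.integral_comp_comm (h.2.1.integrable_smul_left_of_hasCompactSupport hLφ.continuous hLs),
    hderiv] at htest
  simpa only [map_smul, smul_eq_mul] using htest

theorem inner_eq_re_mul_re_add_im_mul_im (z w : ℂ) :
    inner ℝ z w = w.re * z.re + w.im * z.im := by
  simp only [Complex.inner, Complex.mul_re, Complex.conj_re, Complex.conj_im]
  ring

theorem IsWeakDeriv.integral_inner_deriv {φ : ℝ → ℂ} (h : IsWeakDeriv u v)
    (hφ : ContDiff ℝ ∞ φ) (hs : HasCompactSupport φ) :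
    ∫ x, inner ℝ (u x) (deriv φ x) = -∫ x, inner ℝ (v x) (φ x) := by
  have hsplit : ∀ {f ψ : ℝ → ℂ}, LocallyIntegrable f → Continuous ψ → HasCompactSupport ψ →
      ∫ x, inner ℝ (f x) (ψ x) = (∫ x, Complex.reCLM (ψ x) * Complex.reCLM (f x))
        + ∫ x, Complex.imCLM (ψ x) * Complex.imCLM (f x) := fun hf hψ hψs => by
    simp only [inner_eq_re_mul_re_add_im_mul_im]
    exact integral_add (integrable_clm_mul_clm Complex.reCLM hf hψ hψs)
      (integrable_clm_mul_clm Complex.imCLM hf hψ hψs)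
  rw [hsplit h.1 (hφ.continuous_deriv (by simp)) hs.deriv, hsplit h.2.1 hφ.continuous hs,
    h.integral_clm_deriv_mul _ hφ hs, h.integral_clm_deriv_mul _ hφ hs, neg_add]

theorem isWeakDeriv_iff_forall_inner : IsWeakDeriv u v ↔
    LocallyIntegrable u ∧ LocallyIntegrable v ∧
      ∀ φ : ℝ → ℂ, ContDiff ℝ ∞ φ → HasCompactSupport φ →
        ∫ x, inner ℝ (u x) (deriv φ x) = -∫ x, inner ℝ (v x) (φ x) := by
  refine ⟨fun h => ⟨h.1, h.2.1, fun φ => h.integral_inner_deriv⟩, fun ⟨hu, hv, h⟩ =>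
    isWeakDeriv_iff_smul.2 ⟨hu, hv, fun φ hφ hs => ext_inner_left ℝ fun z => ?_⟩⟩
  have hderiv : deriv (fun x => φ x • z) = fun x => deriv φ x • z :=
    funext fun x => ((hφ.differentiable (by simp) x).hasDerivAt.smul_const z).deriv
  rw [inner_neg_right, ← integral_inner (hu.integrable_smul_left_of_hasCompactSupport
      (hφ.continuous_deriv (by simp)) hs.deriv),
    ← integral_inner (hv.integrable_smul_left_of_hasCompactSupport hφ.continuous hs)]
  simpa only [hderiv, real_inner_smul_right, real_inner_comm] using
    h (fun x => φ x • z) (hφ.smul contDiff_const) hs.smul_right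

end WeakDeriv

/-! ### Flux form of the travelling wave equation -/

/-- With `z = u` and `p = u'`, the quantity `u' - 2κ⟨u, u'⟩u` whose derivative appears in the
travelling wave equation. -/
def flux (κ : ℝ) (z p : ℂ) : ℂ := p - (2 * κ * inner ℝ z p) • z

/-- The solution `p` of `flux κ z p = w`, meaningful when `1 - 2κ|z|² ≠ 0`. -/
def fluxInv (κ : ℝ) (z w : ℂ) : ℂ := w + (2 * κ * inner ℝ z w / (1 - 2 * κ * ‖z‖ ^ 2)) • z

/-- The zeroth order part of the travelling wave equation: with `z = u` and `p = u'`, a solution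
satisfies `(flux κ u u')' = -forcing c κ u u'`. -/
def forcing (c κ : ℝ) (z p : ℂ) : ℂ :=
  Complex.I * c * p + z * ((1 - ‖z‖ ^ 2 : ℝ) : ℂ) + (2 * κ * inner ℝ z p) • p

theorem fluxInv_flux {κ : ℝ} {z : ℂ} (h : 1 - 2 * κ * ‖z‖ ^ 2 ≠ 0) (p : ℂ) :
    fluxInv κ z (flux κ z p) = p := by
  have hcoeff : 2 * κ * inner ℝ z (flux κ z p) / (1 - 2 * κ * ‖z‖ ^ 2) = 2 * κ * inner ℝ z p := by
    rw [flux, inner_sub_right, real_inner_smul_right, real_inner_self_eq_norm_sq]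
    field_simp
  rw [fluxInv, hcoeff, flux, sub_add_cancel]

theorem flux_fluxInv {κ : ℝ} {z : ℂ} (h : 1 - 2 * κ * ‖z‖ ^ 2 ≠ 0) (w : ℂ) :
    flux κ z (fluxInv κ z w) = w := by
  have hcoeff : 2 * κ * inner ℝ z (fluxInv κ z w)
      = 2 * κ * inner ℝ z w / (1 - 2 * κ * ‖z‖ ^ 2) := by
    rw [fluxInv, inner_add_right, real_inner_smul_right, real_inner_self_eq_norm_sq]
    field_simp
    ring
  rw [flux, hcoeff, fluxInv, add_sub_cancel_right]

theorem flux_neg (κ : ℝ) (z p : ℂ) : flux κ z (-p) = -flux κ z p := by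
  simp only [flux, inner_neg_right, mul_neg, neg_smul, neg_sub, sub_neg_eq_add]
  ring

theorem forcing_neg (c κ : ℝ) (z p : ℂ) : forcing (-c) κ z (-p) = forcing c κ z p := by
  simp only [forcing, inner_neg_right, mul_neg, smul_neg, neg_smul, neg_neg, Complex.ofReal_neg,
    neg_mul]

theorem inner_forcing_sub_inner_flux (c κ : ℝ) (z p w q : ℂ) :
    inner ℝ (forcing c κ z p) w - inner ℝ (flux κ z p) q
      = inner ℝ (Complex.I * c * p + z * ((1 - ‖z‖ ^ 2 : ℝ) : ℂ)) w - inner ℝ p q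
        + 2 * κ * inner ℝ z p * (inner ℝ p w + inner ℝ z q) := by
  simp only [forcing, flux, inner_add_left, inner_sub_left, real_inner_smul_left]
  ring

section WeakForm

variable {c κ : ℝ} {u v : ℝ → ℂ}

theorem locallyIntegrable_inner_smul (k : ℝ) (hu : Continuous u)
    (hv : AEStronglyMeasurable v) {w : ℝ → ℂ} (hw : AEStronglyMeasurable w)
    (h : LocallyIntegrable fun x => ‖v x‖ * ‖w x‖) :
    LocallyIntegrable fun x => (k * inner ℝ (u x) (v x)) • w x := by
  refine (h.continuous_smul (hu.norm.const_mul |k|)).mono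
    (((hu.aestronglyMeasurable.inner hv).const_mul k).smul hw) (.of_forall fun x => ?_)
  rw [norm_smul, norm_mul, Real.norm_eq_abs k]
  refine le_trans ?_ (le_abs_self _)
  calc |k| * ‖inner ℝ (u x) (v x)‖ * ‖w x‖ ≤ |k| * (‖u x‖ * ‖v x‖) * ‖w x‖ := by
        gcongr
        exact norm_inner_le_norm _ _
    _ = |k| * ‖u x‖ * (‖v x‖ * ‖w x‖) := by ring

theorem locallyIntegrable_flux (κ : ℝ) (hu : Continuous u) (hv : LocallyIntegrable v) :
    LocallyIntegrable fun x => flux κ (u x) (v x) :=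
  have hnorm : LocallyIntegrable fun x => ‖v x‖ :=
    hv.mono hv.aestronglyMeasurable.norm (.of_forall fun _ => (norm_norm _).le)
  hv.sub (locallyIntegrable_inner_smul (2 * κ) hu hv.aestronglyMeasurable hu.aestronglyMeasurable
    (hnorm.mul_continuous hu.norm))

theorem locallyIntegrable_forcing (c κ : ℝ) (hu : Continuous u) (hv : MemLp v 2) :
    LocallyIntegrable fun x => forcing c κ (u x) (v x) := by
  have hlinear : LocallyIntegrable fun x => Complex.I * c * v x :=
    (hv.locallyIntegrable (by norm_num)).smul (Complex.I * c)
  have hpotential : LocallyIntegrable fun x => u x * ((1 - ‖u x‖ ^ 2 : ℝ) : ℂ) :=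
    Continuous.locallyIntegrable (by fun_prop)
  refine (hlinear.add hpotential).add (locallyIntegrable_inner_smul (2 * κ) hu hv.1 hv.1 ?_)
  simpa only [← sq] using ((memLp_two_iff_integrable_sq_norm hv.1).1 hv).locallyIntegrable

theorem isWeakDeriv_flux_iff (hu : Continuous u) (hv : MemLp v 2) :
    IsWeakDeriv (fun x => flux κ (u x) (v x)) (fun x => -forcing c κ (u x) (v x)) ↔
      ∀ φ : ℝ → ℂ, ContDiff ℝ ∞ φ → HasCompactSupport φ →
        ∫ x, (inner ℝ (Complex.I * (c : ℂ) * v x + u x * ((1 - ‖u x‖ ^ 2 : ℝ) : ℂ)) (φ x)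
          - inner ℝ (v x) (deriv φ x)
          + 2 * κ * inner ℝ (u x) (v x)
            * (inner ℝ (v x) (φ x) + inner ℝ (u x) (deriv φ x))) = 0 := by
  have hflux := locallyIntegrable_flux κ hu (hv.locallyIntegrable (by norm_num))
  have hforcing := locallyIntegrable_forcing c κ hu hv
  rw [isWeakDeriv_iff_forall_inner, and_iff_right hflux, and_iff_right (by exact hforcing.neg)]
  refine forall₃_congr fun φ hφ hs => ?_
  simp only [← inner_forcing_sub_inner_flux, inner_neg_left, integral_neg, neg_neg]
  rw [integral_sub (integrable_inner_of_hasCompactSupport hforcing hφ.continuous hs)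
      (integrable_inner_of_hasCompactSupport hflux (hφ.continuous_deriv (by simp)) hs.deriv),
    sub_eq_zero, eq_comm]

end WeakForm

/-- Off the set where `1 - 2κ|u|²` vanishes, weak solutions are classical ones in this sense: `v` is
the continuous derivative of `u`, and the flux has the derivative prescribed by the equation. -/
structure IsClassicalSolutionOn (c κ : ℝ) (s : Set ℝ) (u v : ℝ → ℂ) : Prop where
  hasDerivAt : ∀ x ∈ s, HasDerivAt u (v x) x
  continuousOn : ContinuousOn v s
  hasDerivAt_flux : ∀ x ∈ s,
    HasDerivAt (fun x => flux κ (u x) (v x)) (-forcing c κ (u x) (v x)) x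


namespace IsClassicalSolutionOn

variable {c κ : ℝ} {s : Set ℝ} {u v : ℝ → ℂ}

theorem mono {t : Set ℝ} (h : IsClassicalSolutionOn c κ s u v) (hts : t ⊆ s) :
    IsClassicalSolutionOn c κ t u v where
  hasDerivAt x hx := h.hasDerivAt x (hts hx)
  continuousOn := h.continuousOn.mono hts
  hasDerivAt_flux x hx := h.hasDerivAt_flux x (hts hx)

theorem comp_neg {t : Set ℝ} (h : IsClassicalSolutionOn c κ s u v) (hts : Set.MapsTo Neg.neg t s) :
    IsClassicalSolutionOn (-c) κ t (fun x => u (-x)) (fun x => -v (-x)) where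
  hasDerivAt x hx := by
    simpa [Function.comp_def] using (h.hasDerivAt _ (hts hx)).scomp x (hasDerivAt_neg x)
  continuousOn := (h.continuousOn.comp continuous_neg.continuousOn hts).neg
  hasDerivAt_flux x hx := by
    simpa [Function.comp_def, flux_neg, forcing_neg] using
      ((h.hasDerivAt_flux _ (hts hx)).scomp x (hasDerivAt_neg x)).fun_neg

end IsClassicalSolutionOn

theorem one_sub_ne_zero_iff_notMem_singularSet {κ : ℝ} (hκ : 0 < κ) {u : ℝ → ℂ} {x : ℝ} :
    1 - 2 * κ * ‖u x‖ ^ 2 ≠ 0 ↔ x ∉ singularSet κ u := by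
  rw [singularSet, Set.mem_ofPred_eq, eq_div_iff (by positivity), ne_eq, not_iff_not, sub_eq_zero,
    eq_comm, mul_comm]

theorem continuousAt_fluxInv {κ : ℝ} {u w : ℝ → ℂ} {x : ℝ} (hu : Continuous u)
    (hw : Continuous w) (hx : 1 - 2 * κ * ‖u x‖ ^ 2 ≠ 0) :
    ContinuousAt (fun x => fluxInv κ (u x) (w x)) x := by
  unfold fluxInv
  fun_prop (disch := assumption)

theorem continuousAt_forcing {c κ : ℝ} {u v : ℝ → ℂ} {x : ℝ} (hu : Continuous u)
    (hv : ContinuousAt v x) : ContinuousAt (fun x => forcing c κ (u x) (v x)) x := by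
  unfold forcing
  fun_prop

theorem isClassicalSolutionOn_of_isWeakDeriv_flux {c κ : ℝ} {u v w : ℝ → ℂ} (hκ : 0 < κ)
    (hu : Continuous u) (hv : IsWeakDeriv u v)
    (hflux : IsWeakDeriv (fun x => flux κ (u x) (v x)) (fun x => -forcing c κ (u x) (v x)))
    (hw : Continuous w) (hae : ∀ᵐ x, flux κ (u x) (v x) = w x)
    (hvw : ∀ x ∉ singularSet κ u, v x = fluxInv κ (u x) (w x)) :
    IsClassicalSolutionOn c κ (singularSet κ u)ᶜ u v := by
  have hopen : IsOpen (singularSet κ u)ᶜ :=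
    (isClosed_eq (hu.norm.pow 2) continuous_const).isOpen_compl
  have hcont : ∀ x ∉ singularSet κ u, ContinuousAt v x := fun x hx =>
    (continuousAt_fluxInv hu hw ((one_sub_ne_zero_iff_notMem_singularSet hκ).2 hx)).congr
      (Filter.eventually_of_mem (hopen.mem_nhds hx) fun y hy => (hvw y hy).symm)
  refine ⟨fun x hx => hv.hasDerivAt hu (hcont x hx), fun x hx => (hcont x hx).continuousWithinAt,
    fun x hx => ?_⟩
  refine ((hflux.congr_ae hae .rfl).hasDerivAt hw
    (continuousAt_forcing hu (hcont x hx)).neg).congr_of_eventuallyEq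
      (Filter.eventually_of_mem (hopen.mem_nhds hx) fun y hy => ?_)
  simp only
  rw [hvw y hy, flux_fluxInv ((one_sub_ne_zero_iff_notMem_singularSet hκ).2 hy)]

theorem exists_isClassicalSolutionOn {c κ : ℝ} {u : ℝ → ℂ} (hκ : 0 < κ) (hu : MemEnergySpace u)
    (hsol : IsWeakSolution c κ u) :
    ∃ v, IsClassicalSolutionOn c κ (singularSet κ u)ᶜ u v ∧ MemLp v 2 := by
  obtain ⟨huc, -, v₁, hv₁, hL₁⟩ := hu
  obtain ⟨v₀, hv₀, htest⟩ := hsol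
  have hL₀ : MemLp v₀ 2 := (memLp_congr_ae (hv₀.ae_eq hv₁)).2 hL₁
  have hflux := (isWeakDeriv_flux_iff huc hL₀).2 htest
  obtain ⟨C, hC⟩ := hflux.exists_ae_eq_primitive
  set w : ℝ → ℂ := fun x => C + ∫ t in (0 : ℝ)..x, -forcing c κ (u t) (v₀ t)
  classical
  let v := (singularSet κ u).piecewise v₀ fun x => fluxInv κ (u x) (w x)
  have hv_notMem : ∀ x ∉ singularSet κ u, v x = fluxInv κ (u x) (w x) := fun x hx =>
    Set.piecewise_eq_of_notMem _ _ _ hx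
  have hae : v₀ =ᵐ[volume] v := hC.mono fun x hx => by
    by_cases hmem : x ∈ singularSet κ u
    · exact (Set.piecewise_eq_of_mem _ _ _ hmem).symm
    · rw [hv_notMem x hmem, show w x = flux κ (u x) (v₀ x) from hx.symm,
        fluxInv_flux ((one_sub_ne_zero_iff_notMem_singularSet hκ).2 hmem)]
  have hflux_v : IsWeakDeriv (fun x => flux κ (u x) (v x)) (fun x => -forcing c κ (u x) (v x)) :=
    hflux.congr_ae (hae.mono fun x hx => by simp only [hx]) (hae.mono fun x hx => by simp only [hx])
  exact ⟨v, isClassicalSolutionOn_of_isWeakDeriv_flux hκ huc (hv₀.congr_ae .rfl hae) hflux_v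
    (continuous_const.add hflux.continuous_primitive) ((hC.and hae).mono fun x hx => hx.2 ▸ hx.1)
    hv_notMem, (memLp_congr_ae hae).1 hL₀⟩

/-! ### The cuspon is a weak solution of finite energy -/

theorem inner_logDeriv_mul (a b : ℝ) (z : ℂ) :
    inner ℝ z ((a + Complex.I * b) * z) = a * ‖z‖ ^ 2 := by
  rw [inner_eq_re_mul_re_add_im_mul_im, Complex.sq_norm, Complex.normSq_apply]
  simp only [Complex.mul_re, Complex.mul_im, Complex.add_re, Complex.add_im, Complex.ofReal_re,
    Complex.ofReal_im, Complex.I_re, Complex.I_im]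
  ring

theorem flux_logDeriv_mul (κ a b : ℝ) (z : ℂ) :
    flux κ z ((a + Complex.I * b) * z) = ((a * (1 - 2 * κ * ‖z‖ ^ 2) : ℝ) + Complex.I * b) * z := by
  rw [flux, inner_logDeriv_mul, Complex.real_smul]
  push_cast
  ring

/-- In terms of the logarithmic derivative `α + iβ` of `u`, the flux equation is the pair of real
equations `ρ' = β² - α² + cβ - (1 - |u|²)` and `β' = -α(2β + c)`, where `ρ = α(1 - 2κ|u|²)`. -/
theorem hasDerivAt_flux_of_logDeriv {c κ a x : ℝ} {ρ β : ℝ → ℝ} {u : ℝ → ℂ}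
    (hu : HasDerivAt u ((a + Complex.I * β x) * u x) x) (hρx : ρ x = a * (1 - 2 * κ * ‖u x‖ ^ 2))
    (hρ : HasDerivAt ρ (β x ^ 2 - a ^ 2 + c * β x - (1 - ‖u x‖ ^ 2)) x)
    (hβ : HasDerivAt β (-(a * (2 * β x + c))) x) :
    HasDerivAt (fun y => ((ρ y : ℂ) + Complex.I * β y) * u y)
      (-forcing c κ (u x) ((a + Complex.I * β x) * u x)) x := by
  refine ((hρ.ofReal_comp.add (hβ.ofReal_comp.const_mul Complex.I)).fun_mul hu).congr_deriv ?_
  simp only [Pi.add_apply]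
  rw [forcing, inner_logDeriv_mul, hρx, Complex.real_smul]
  push_cast
  linear_combination (β x ^ 2 * u x + c * β x * u x) * Complex.I_sq

/-- The quotient `r = η / (1 - η)`; the phase of the cuspon has the derivative `c r / 2`. -/
def cuspRatio (c κ x : ℝ) : ℝ := cuspProfile c κ x / (1 - cuspProfile c κ x)

/-- The derivative of the cuspon away from the origin: `η' = -η / t` for the index `t`, which gives
the logarithmic derivative `r / (2t) + i c r / 2`. -/
def cusponDeriv (c κ x : ℝ) : ℂ :=
  (((cuspRatio c κ x / (2 * cuspIndex c κ x) : ℝ) : ℂ)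
    + Complex.I * (c / 2 * cuspRatio c κ x : ℝ)) * cuspon c κ x

/-- The real part of the quotient of the flux of the cuspon by the cuspon. Unlike the derivative
of the cuspon it has no singularity at the origin. -/
def cuspFluxRatio (c κ x : ℝ) : ℝ :=
  cuspRatio c κ x * cuspIndex c κ x * (2 - c ^ 2 - 2 * cuspProfile c κ x) / 2

/-- The continuous representative of the flux of the cuspon. -/
def cusponFlux (c κ x : ℝ) : ℂ :=
  ((cuspFluxRatio c κ x : ℂ) + Complex.I * (c / 2 * cuspRatio c κ x : ℝ)) * cuspon c κ x

namespace IsCuspParam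

variable {c κ x : ℝ}

theorem cuspIndex_ne_zero (h : IsCuspParam c κ) (hx : x ≠ 0) : cuspIndex c κ x ≠ 0 :=
  travelIndex_ne_zero h.kappa_pos h.speedRatio_nonneg hx

theorem one_sub_mul_cuspIndex_sq_pos (h : IsCuspParam c κ) (x : ℝ) :
    0 < 1 - speedRatio c κ * cuspIndex c κ x ^ 2 :=
  one_sub_pos_of_mem_indexDomain (travelIndex_mem h.kappa_pos h.speedRatio_nonneg x)

theorem continuous_cuspIndex (h : IsCuspParam c κ) : Continuous (cuspIndex c κ) :=
  continuous_travelIndex h.kappa_pos h.speedRatio_nonneg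

theorem one_sub_cuspProfile (h : IsCuspParam c κ) (x : ℝ) :
    1 - cuspProfile c κ x
      = (1 + c ^ 2 * cuspIndex c κ x ^ 2) / (2 * (κ + cuspIndex c κ x ^ 2)) := by
  have := h.kappa_pos
  have : κ + cuspIndex c κ x ^ 2 ≠ 0 := by positivity
  rw [h.cuspProfile_eq, profileValue, show c ^ 2 = 2 - (1 - 2 * κ) * speedRatio c κ by
    linarith [h.two_sub_speed_sq]]
  field_simp
  ring

theorem one_sub_cuspProfile_pos (h : IsCuspParam c κ) (x : ℝ) : 0 < 1 - cuspProfile c κ x := by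
  have := h.kappa_pos
  rw [h.one_sub_cuspProfile]
  positivity

theorem cuspProfile_denom (h : IsCuspParam c κ) (x : ℝ) :
    1 - 2 * κ + 2 * κ * cuspProfile c κ x
      = cuspIndex c κ x ^ 2 * (2 - c ^ 2 - 2 * cuspProfile c κ x) := by
  rw [h.cuspProfile_eq, profileValue_denom h.kappa_pos, h.two_sub_speed_sq,
    profileValue_numer h.kappa_pos]

theorem cuspRatio_mul (h : IsCuspParam c κ) (x : ℝ) :
    cuspRatio c κ x * (1 - cuspProfile c κ x) = cuspProfile c κ x :=
  div_mul_cancel₀ _ (h.one_sub_cuspProfile_pos x).ne'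

theorem continuous_cuspProfile (h : IsCuspParam c κ) : Continuous (cuspProfile c κ) := by
  have := h.kappa_pos
  rw [funext h.cuspProfile_eq]
  exact (continuous_iff_continuousAt.2 fun t =>
    (hasDerivAt_profileValue h.kappa_pos _ t).continuousAt).comp h.continuous_cuspIndex

theorem continuous_cuspRatio (h : IsCuspParam c κ) : Continuous (cuspRatio c κ) :=
  h.continuous_cuspProfile.div (continuous_const.sub h.continuous_cuspProfile)
    fun x => (h.one_sub_cuspProfile_pos x).ne'

theorem hasDerivAt_cuspPhase (h : IsCuspParam c κ) (x : ℝ) :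
    HasDerivAt (cuspPhase c κ) (c / 2 * cuspRatio c κ x) x :=
  (h.continuous_cuspRatio.integral_hasStrictDerivAt 0 x).hasDerivAt.const_mul (c / 2)

theorem continuous_cuspon (h : IsCuspParam c κ) : Continuous (cuspon c κ) := by
  have hprofile := h.continuous_cuspProfile
  have hphase : Continuous (cuspPhase c κ) :=
    continuous_iff_continuousAt.2 fun x => (h.hasDerivAt_cuspPhase x).continuousAt
  unfold cuspon
  fun_prop

theorem norm_sq_cuspon (h : IsCuspParam c κ) (x : ℝ) :
    ‖cuspon c κ x‖ ^ 2 = 1 - cuspProfile c κ x := by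
  rw [cuspon, norm_mul, mul_comm Complex.I, Complex.norm_exp_ofReal_mul_I, mul_one,
    Complex.norm_real, Real.norm_eq_abs, sq_abs, Real.sq_sqrt (h.one_sub_cuspProfile_pos x).le]

theorem cuspon_ne_zero (h : IsCuspParam c κ) (x : ℝ) : cuspon c κ x ≠ 0 := by
  intro hzero
  have hpos := h.one_sub_cuspProfile_pos x
  rw [← h.norm_sq_cuspon, hzero] at hpos
  simp at hpos

theorem hasDerivAt_cuspIndex (h : IsCuspParam c κ) (hx : x ≠ 0) :
    HasDerivAt (cuspIndex c κ) ((κ + cuspIndex c κ x ^ 2)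
      * (1 - speedRatio c κ * cuspIndex c κ x ^ 2)
        / (2 * cuspIndex c κ x ^ 2 * (1 + speedRatio c κ * κ))) x :=
  hasDerivAt_travelIndex h.kappa_pos h.speedRatio_nonneg hx

theorem hasDerivAt_cuspProfile (h : IsCuspParam c κ) (hx : x ≠ 0) :
    HasDerivAt (cuspProfile c κ) (-(cuspProfile c κ x / cuspIndex c κ x)) x := by
  have := h.kappa_pos
  have := h.speedRatio_nonneg
  have := h.cuspIndex_ne_zero hx
  have : κ + cuspIndex c κ x ^ 2 ≠ 0 := by positivity
  rw [funext h.cuspProfile_eq]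
  refine ((hasDerivAt_profileValue h.kappa_pos _ _).comp x
    (h.hasDerivAt_cuspIndex hx)).congr_deriv ?_
  unfold profileValue
  field_simp
  ring

theorem hasDerivAt_cuspRatio (h : IsCuspParam c κ) (hx : x ≠ 0) :
    HasDerivAt (cuspRatio c κ)
      (-((cuspRatio c κ x ^ 2 + cuspRatio c κ x) / cuspIndex c κ x)) x := by
  have := h.cuspIndex_ne_zero hx
  have := (h.one_sub_cuspProfile_pos x).ne'
  refine ((h.hasDerivAt_cuspProfile hx).fun_div ((h.hasDerivAt_cuspProfile hx).const_sub 1)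
    this).congr_deriv ?_
  unfold cuspRatio
  field_simp
  ring

theorem numer_mul_deriv_cuspIndex (h : IsCuspParam c κ) (hx : x ≠ 0) :
    (2 - c ^ 2 - 2 * cuspProfile c κ x) * deriv (cuspIndex c κ) x
      = -(cuspProfile c κ x * (κ + cuspIndex c κ x ^ 2) / cuspIndex c κ x ^ 2) := by
  have := h.kappa_pos
  have := h.speedRatio_nonneg
  have := h.cuspIndex_ne_zero hx
  have : κ + cuspIndex c κ x ^ 2 ≠ 0 := by positivity
  rw [(h.hasDerivAt_cuspIndex hx).deriv, h.two_sub_speed_sq, h.cuspProfile_eq,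
    profileValue_numer h.kappa_pos, profileValue]
  field_simp
  ring

theorem hasDerivAt_cuspFluxRatio (h : IsCuspParam c κ) (hx : x ≠ 0) :
    HasDerivAt (cuspFluxRatio c κ) ((c / 2 * cuspRatio c κ x) ^ 2
      - (cuspRatio c κ x / (2 * cuspIndex c κ x)) ^ 2 + c * (c / 2 * cuspRatio c κ x)
      - cuspProfile c κ x) x := by
  have := h.cuspIndex_ne_zero hx
  have hindex := (h.hasDerivAt_cuspIndex hx).differentiableAt.hasDerivAt
  have hratio := h.cuspRatio_mul x
  have hdenom := h.cuspProfile_denom x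
  have hindex_mul := h.numer_mul_deriv_cuspIndex hx
  refine ((((h.hasDerivAt_cuspRatio hx).fun_mul hindex).fun_mul
    (((h.hasDerivAt_cuspProfile hx).const_mul 2).const_sub (2 - c ^ 2))).div_const 2).congr_deriv ?_
  generalize deriv (cuspIndex c κ) x = d at *
  generalize cuspIndex c κ x = t at *
  generalize cuspRatio c κ x = r at *
  generalize cuspProfile c κ x = y at *
  field_simp at hindex_mul ⊢
  linear_combination 2 * r * hindex_mul + r ^ 2 * hdenom
    + (2 * κ * r - 2 * t ^ 2 * r - 4 * t ^ 2) * hratio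

theorem hasDerivAt_cuspon (h : IsCuspParam c κ) (hx : x ≠ 0) :
    HasDerivAt (cuspon c κ) (cusponDeriv c κ x) x := by
  have hpos := h.one_sub_cuspProfile_pos x
  have hmodulus := (((h.hasDerivAt_cuspProfile hx).const_sub 1).sqrt hpos.ne').ofReal_comp
  have hphase := ((h.hasDerivAt_cuspPhase x).ofReal_comp.const_mul Complex.I).cexp
  have hlogDeriv : - -(cuspProfile c κ x / cuspIndex c κ x) / (2 * √(1 - cuspProfile c κ x))
      = cuspRatio c κ x / (2 * cuspIndex c κ x) * √(1 - cuspProfile c κ x) := by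
    have := h.cuspIndex_ne_zero hx
    have := (Real.sqrt_pos.2 hpos).ne'
    field_simp
    rw [Real.sq_sqrt hpos.le, mul_comm, h.cuspRatio_mul]
  refine (hmodulus.mul hphase).congr_deriv ?_
  rw [hlogDeriv, cusponDeriv, cuspon]
  push_cast
  ring

theorem cuspFluxRatio_eq (h : IsCuspParam c κ) (hx : x ≠ 0) :
    cuspFluxRatio c κ x = cuspRatio c κ x / (2 * cuspIndex c κ x)
      * (1 - 2 * κ * ‖cuspon c κ x‖ ^ 2) := by
  have := h.cuspIndex_ne_zero hx
  rw [cuspFluxRatio, h.norm_sq_cuspon,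
    show 1 - 2 * κ * (1 - cuspProfile c κ x) = 1 - 2 * κ + 2 * κ * cuspProfile c κ x by ring,
    h.cuspProfile_denom]
  field_simp

theorem flux_cuspon (h : IsCuspParam c κ) (hx : x ≠ 0) :
    flux κ (cuspon c κ x) (cusponDeriv c κ x) = cusponFlux c κ x := by
  rw [cusponDeriv, flux_logDeriv_mul, cusponFlux, h.cuspFluxRatio_eq hx]

theorem hasDerivAt_cusponFlux (h : IsCuspParam c κ) (hx : x ≠ 0) :
    HasDerivAt (cusponFlux c κ) (-forcing c κ (cuspon c κ x) (cusponDeriv c κ x)) x := by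
  refine hasDerivAt_flux_of_logDeriv (h.hasDerivAt_cuspon hx) (h.cuspFluxRatio_eq hx) ?_ ?_
  · simpa only [h.norm_sq_cuspon, sub_sub_cancel] using h.hasDerivAt_cuspFluxRatio hx
  · refine ((h.hasDerivAt_cuspRatio hx).const_mul (c / 2)).congr_deriv ?_
    have := h.cuspIndex_ne_zero hx
    field_simp

theorem continuous_cusponFlux (h : IsCuspParam c κ) : Continuous (cusponFlux c κ) := by
  have := h.continuous_cuspIndex
  have := h.continuous_cuspProfile
  have := h.continuous_cuspRatio
  have := h.continuous_cuspon
  unfold cusponFlux cuspFluxRatio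
  fun_prop

theorem norm_sq_cusponDeriv (h : IsCuspParam c κ) (hx : x ≠ 0) :
    ‖cusponDeriv c κ x‖ ^ 2
      = cuspProfile c κ x ^ 2 * (κ + cuspIndex c κ x ^ 2) / (2 * cuspIndex c κ x ^ 2) := by
  have := h.kappa_pos
  have := h.cuspIndex_ne_zero hx
  have : κ + cuspIndex c κ x ^ 2 ≠ 0 := by positivity
  have : 1 + c ^ 2 * cuspIndex c κ x ^ 2 ≠ 0 := by positivity
  rw [cusponDeriv, norm_mul, mul_pow, mul_comm Complex.I, Complex.sq_norm (_ + _),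
    Complex.normSq_add_mul_I, h.norm_sq_cuspon, cuspRatio, h.one_sub_cuspProfile]
  field_simp

theorem measurable_cusponDeriv (h : IsCuspParam c κ) : Measurable (cusponDeriv c κ) := by
  have := h.continuous_cuspIndex.measurable
  have := h.continuous_cuspRatio.measurable
  have := h.continuous_cuspon.measurable
  unfold cusponDeriv
  fun_prop

theorem integrableOn_Ioi_indexWeight (h : IsCuspParam c κ) : IntegrableOn
    (fun x => (1 - speedRatio c κ * cuspIndex c κ x ^ 2) / cuspIndex c κ x ^ 2) (Set.Ioi 0) := by
  have hκ := h.kappa_pos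
  have hA := h.speedRatio_nonneg
  set C : ℝ := 2 * (1 + speedRatio c κ * κ) / κ
  have hC : 0 ≤ C := by positivity
  let G : ℝ → ℝ := fun x => C * (√κ * Real.arctan (cuspIndex c κ x / √κ))
  have hmono : Monotone G := fun x y hxy => by
    have := (strictMono_travelIndex hκ hA).monotone hxy
    exact mul_le_mul_of_nonneg_left (mul_le_mul_of_nonneg_left
      (Real.arctan_mono (by unfold cuspIndex; gcongr)) (Real.sqrt_nonneg κ)) hC
  have hbdd : BddAbove (Set.range G) := by
    refine ⟨C * (√κ * (Real.pi / 2)), ?_⟩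
    rintro _ ⟨x, rfl⟩
    have := Real.arctan_lt_pi_div_two (cuspIndex c κ x / √κ)
    dsimp only [G]
    gcongr
  refine integrableOn_Ioi_deriv_of_nonneg (g := G) ?_ (fun x hx => ?_)
    (fun x _ => div_nonneg (h.one_sub_mul_cuspIndex_sq_pos x).le (sq_nonneg _))
    (tendsto_atTop_ciSup hmono hbdd)
  · have := h.continuous_cuspIndex
    exact (by fun_prop : Continuous G).continuousWithinAt
  · have hx0 : x ≠ 0 := ne_of_gt hx
    have := h.cuspIndex_ne_zero hx0
    refine (((hasDerivAt_sqrt_mul_arctan hκ _).comp x (h.hasDerivAt_cuspIndex hx0)).const_mul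
      C).congr_deriv ?_
    have : κ + cuspIndex c κ x ^ 2 ≠ 0 := by positivity
    dsimp only [C]
    field_simp

theorem integrable_indexWeight (h : IsCuspParam c κ) : Integrable fun x =>
    (1 - speedRatio c κ * cuspIndex c κ x ^ 2) / cuspIndex c κ x ^ 2 := by
  have hpos := h.integrableOn_Ioi_indexWeight
  have hneg := IntegrableOn.comp_neg_Iio (by rwa [neg_zero] : IntegrableOn _ (Set.Ioi (-(0 : ℝ))))
  simp only [cuspIndex, travelIndex_neg h.kappa_pos h.speedRatio_nonneg, even_two.neg_pow] at hneg
  rw [← integrableOn_univ, ← Set.Iic_union_Ioi (a := (0 : ℝ)), integrableOn_union,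
    integrableOn_Iic_iff_integrableOn_Iio]
  exact ⟨hneg, hpos⟩

theorem norm_sq_cusponDeriv_le (h : IsCuspParam c κ) (hx : x ≠ 0) :
    ‖cusponDeriv c κ x‖ ^ 2 ≤ (1 - 2 * κ) ^ 2 / (8 * κ)
      * ((1 - speedRatio c κ * cuspIndex c κ x ^ 2) / cuspIndex c κ x ^ 2) := by
  have := h.kappa_pos
  have hpos := h.one_sub_mul_cuspIndex_sq_pos x
  have := h.cuspIndex_ne_zero hx
  rw [h.norm_sq_cusponDeriv hx, h.cuspProfile_eq, profileValue]
  generalize cuspIndex c κ x = t at *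
  have hle : 1 - speedRatio c κ * t ^ 2 ≤ 1 :=
    sub_le_self _ (mul_nonneg h.speedRatio_nonneg (sq_nonneg t))
  calc _ = (1 - 2 * κ) ^ 2 / (8 * (κ + t ^ 2)) * ((1 - speedRatio c κ * t ^ 2) / t ^ 2)
        * (1 - speedRatio c κ * t ^ 2) := by
        field_simp
        ring
    _ ≤ (1 - 2 * κ) ^ 2 / (8 * κ) * ((1 - speedRatio c κ * t ^ 2) / t ^ 2) * 1 := by
        gcongr
        exact le_add_of_nonneg_right (sq_nonneg t)
    _ = _ := mul_one _

theorem sq_cuspProfile_le (h : IsCuspParam c κ) (hx : x ≠ 0) :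
    cuspProfile c κ x ^ 2 ≤ 2 * ‖cusponDeriv c κ x‖ ^ 2 := by
  have := h.kappa_pos
  have := h.cuspIndex_ne_zero hx
  calc cuspProfile c κ x ^ 2
      ≤ cuspProfile c κ x ^ 2 + cuspProfile c κ x ^ 2 * κ / cuspIndex c κ x ^ 2 :=
        le_add_of_nonneg_right (by positivity)
    _ = 2 * ‖cusponDeriv c κ x‖ ^ 2 := by
        rw [h.norm_sq_cusponDeriv hx]
        field_simp
        ring

theorem memLp_cusponDeriv (h : IsCuspParam c κ) : MemLp (cusponDeriv c κ) 2 := by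
  have hmeas := h.measurable_cusponDeriv.aestronglyMeasurable (μ := volume)
  rw [memLp_two_iff_integrable_sq_norm hmeas]
  refine (h.integrable_indexWeight.const_mul ((1 - 2 * κ) ^ 2 / (8 * κ))).mono'
    (hmeas.norm.pow 2) ?_
  filter_upwards [compl_mem_ae_iff.2 (measure_singleton (0 : ℝ))] with x hx
  rw [Real.norm_of_nonneg (sq_nonneg _)]
  exact h.norm_sq_cusponDeriv_le hx

theorem memLp_cuspProfile (h : IsCuspParam c κ) : MemLp (cuspProfile c κ) 2 := by
  have hmeas := h.continuous_cuspProfile.aestronglyMeasurable (μ := volume)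
  have hderiv := h.memLp_cusponDeriv
  rw [memLp_two_iff_integrable_sq hmeas]
  refine (((memLp_two_iff_integrable_sq_norm hderiv.1).1 hderiv).const_mul 2).mono' (hmeas.pow 2) ?_
  filter_upwards [compl_mem_ae_iff.2 (measure_singleton (0 : ℝ))] with x hx
  rw [Real.norm_of_nonneg (sq_nonneg _)]
  exact h.sq_cuspProfile_le hx

theorem isWeakDeriv_cuspon (h : IsCuspParam c κ) : IsWeakDeriv (cuspon c κ) (cusponDeriv c κ) :=
  isWeakDeriv_of_hasDerivAt_of_ne 0 h.continuous_cuspon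
    (h.memLp_cusponDeriv.locallyIntegrable (by norm_num)) fun _ => h.hasDerivAt_cuspon

theorem memEnergySpace_cuspon (h : IsCuspParam c κ) : MemEnergySpace (cuspon c κ) :=
  ⟨h.continuous_cuspon, by simpa only [h.norm_sq_cuspon, sub_sub_cancel] using h.memLp_cuspProfile,
    cusponDeriv c κ, h.isWeakDeriv_cuspon, h.memLp_cusponDeriv⟩

theorem isWeakSolution_cuspon (h : IsCuspParam c κ) : IsWeakSolution c κ (cuspon c κ) := by
  refine ⟨cusponDeriv c κ, h.isWeakDeriv_cuspon,
    (isWeakDeriv_flux_iff h.continuous_cuspon h.memLp_cusponDeriv).1 ?_⟩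
  refine (isWeakDeriv_of_hasDerivAt_of_ne 0 h.continuous_cusponFlux
    (locallyIntegrable_forcing c κ h.continuous_cuspon h.memLp_cusponDeriv).neg
    fun _ => h.hasDerivAt_cusponFlux).congr_ae ?_ .rfl
  filter_upwards [compl_mem_ae_iff.2 (measure_singleton (0 : ℝ))] with x hx
  exact (h.flux_cuspon hx).symm

theorem cuspIndex_eq_zero_iff (h : IsCuspParam c κ) : cuspIndex c κ x = 0 ↔ x = 0 := by
  refine ⟨not_imp_not.1 h.cuspIndex_ne_zero, ?_⟩
  rintro rfl
  exact travelIndex_zero h.kappa_pos h.speedRatio_nonneg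

theorem singularSet_cuspon (h : IsCuspParam c κ) : singularSet κ (cuspon c κ) = {0} := by
  ext x
  have hnumer : 2 - c ^ 2 - 2 * cuspProfile c κ x ≠ 0 := by
    have := h.kappa_pos
    have := h.speedRatio_nonneg
    have := one_sub_two_mul_ne_zero h.kappa_ne_half
    rw [h.cuspProfile_eq, h.two_sub_speed_sq, profileValue_numer h.kappa_pos]
    positivity
  rw [← not_iff_not, ← one_sub_ne_zero_iff_notMem_singularSet h.kappa_pos, h.norm_sq_cuspon,
    show 1 - 2 * κ * (1 - cuspProfile c κ x) = 1 - 2 * κ + 2 * κ * cuspProfile c κ x by ring,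
    h.cuspProfile_denom, not_iff_not, mul_eq_zero, or_iff_left hnumer, sq_eq_zero_iff,
    h.cuspIndex_eq_zero_iff, Set.mem_singleton_iff]

theorem not_isTrivial_cuspon (h : IsCuspParam c κ) : ¬ IsTrivial (cuspon c κ) := by
  rintro ⟨φ, hφ⟩
  have hzero : (0 : ℝ) ∈ singularSet κ (cuspon c κ) := h.singularSet_cuspon ▸ rfl
  have := h.kappa_pos
  rw [singularSet, Set.mem_ofPred_eq, hφ, mul_comm Complex.I, Complex.norm_exp_ofReal_mul_I,
    eq_div_iff (by positivity)] at hzero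
  exact one_sub_two_mul_ne_zero h.kappa_ne_half (by linarith)

end IsCuspParam

/-! ### First integrals of the travelling wave equation -/

theorem inner_I_mul_flux (κ : ℝ) (z p : ℂ) :
    inner ℝ (Complex.I * z) (flux κ z p) = inner ℝ (Complex.I * z) p := by
  simp only [flux, inner_eq_re_mul_re_add_im_mul_im, Complex.sub_re, Complex.sub_im,
    Complex.smul_re, Complex.smul_im, Complex.I_mul_re, Complex.I_mul_im, smul_eq_mul]
  ring

theorem inner_flux_self (κ : ℝ) (z p : ℂ) :
    inner ℝ z (flux κ z p) = (1 - 2 * κ * ‖z‖ ^ 2) * inner ℝ z p := by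
  rw [flux, inner_sub_right, real_inner_smul_right, real_inner_self_eq_norm_sq]
  ring

theorem inner_deriv_flux (κ : ℝ) (z p : ℂ) :
    inner ℝ p (flux κ z p) = ‖p‖ ^ 2 - 2 * κ * inner ℝ z p ^ 2 := by
  rw [flux, inner_sub_right, real_inner_smul_right, real_inner_self_eq_norm_sq, real_inner_comm]
  ring

theorem norm_sq_flux (κ : ℝ) (z p : ℂ) :
    ‖flux κ z p‖ ^ 2
      = ‖p‖ ^ 2 - 4 * κ * inner ℝ z p ^ 2 + 4 * κ ^ 2 * inner ℝ z p ^ 2 * ‖z‖ ^ 2 := by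
  rw [flux, norm_sub_sq_real, real_inner_smul_right, norm_smul, Real.norm_eq_abs, mul_pow, sq_abs,
    real_inner_comm]
  ring

theorem norm_sq_mul_norm_sq_eq (z p : ℂ) :
    ‖z‖ ^ 2 * ‖p‖ ^ 2 = inner ℝ z p ^ 2 + inner ℝ (Complex.I * z) p ^ 2 := by
  simp only [Complex.sq_norm, Complex.normSq_apply, inner_eq_re_mul_re_add_im_mul_im,
    Complex.I_mul_re, Complex.I_mul_im]
  ring

theorem inner_I_mul_flux_sub_inner_forcing (c κ : ℝ) (z p : ℂ) :
    inner ℝ (Complex.I * p) (flux κ z p) - inner ℝ (Complex.I * z) (forcing c κ z p)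
      = -(c * inner ℝ z p) := by
  simp only [flux, forcing, inner_eq_re_mul_re_add_im_mul_im, Complex.add_re, Complex.add_im,
    Complex.sub_re, Complex.sub_im, Complex.mul_re, Complex.mul_im, Complex.smul_re,
    Complex.smul_im, Complex.I_re, Complex.I_im, Complex.ofReal_re, Complex.ofReal_im, smul_eq_mul]
  ring

theorem inner_deriv_forcing (c κ : ℝ) (z p : ℂ) :
    inner ℝ p (forcing c κ z p) = inner ℝ z p * (1 - ‖z‖ ^ 2 + 2 * κ * ‖p‖ ^ 2) := by
  rw [← real_inner_self_eq_norm_sq p]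
  simp only [forcing, inner_eq_re_mul_re_add_im_mul_im, Complex.add_re, Complex.add_im,
    Complex.mul_re, Complex.mul_im, Complex.smul_re, Complex.smul_im, Complex.I_re, Complex.I_im,
    Complex.ofReal_re, Complex.ofReal_im, smul_eq_mul]
  ring

theorem inner_flux_forcing (c κ : ℝ) (z p : ℂ) :
    inner ℝ (flux κ z p) (forcing c κ z p) = inner ℝ z p * (1 - ‖z‖ ^ 2 + 2 * κ * ‖p‖ ^ 2)
      - 2 * κ * inner ℝ z p * inner ℝ z (forcing c κ z p) := by
  rw [flux, inner_sub_left, real_inner_smul_left, inner_deriv_forcing]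

section FirstIntegrals

variable {c κ x : ℝ} {s : Set ℝ} {u v : ℝ → ℂ}

namespace IsClassicalSolutionOn

theorem hasDerivAt_momentum (h : IsClassicalSolutionOn c κ s u v) (hx : x ∈ s) :
    HasDerivAt (fun y => inner ℝ (Complex.I * u y) (v y) - c / 2 * (1 - ‖u y‖ ^ 2)) 0 x := by
  have hu := h.hasDerivAt x hx
  have hmomentum := ((hu.const_mul Complex.I).inner ℝ (h.hasDerivAt_flux x hx)).sub
    ((hu.norm_sq.const_sub 1).const_mul (c / 2))
  simp only [inner_I_mul_flux] at hmomentum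
  refine hmomentum.congr_deriv ?_
  rw [inner_neg_right]
  linear_combination inner_I_mul_flux_sub_inner_forcing c κ (u x) (v x)

/-- As `v` is only known to be continuous, the energy is differentiated as a function of `u` and
of the flux `w`: it equals `|w|² + 2κ⟨u, w⟩² / (1 - 2κ|u|²) - (1 - |u|²)² / 2`. -/
theorem hasDerivAt_energy (h : IsClassicalSolutionOn c κ s u v) (hs : IsOpen s)
    (hne : ∀ y ∈ s, 1 - 2 * κ * ‖u y‖ ^ 2 ≠ 0) (hx : x ∈ s) :
    HasDerivAt (fun y => ‖v y‖ ^ 2 - 2 * κ * inner ℝ (u y) (v y) ^ 2 - (1 - ‖u y‖ ^ 2) ^ 2 / 2)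
      0 x := by
  have hu := h.hasDerivAt x hx
  have hw := h.hasDerivAt_flux x hx
  have henergy := (hw.norm_sq.fun_add ((((hu.inner ℝ hw).fun_pow 2).const_mul (2 * κ)).fun_div
    ((hu.norm_sq.const_mul (2 * κ)).const_sub 1) (hne x hx))).fun_sub
      (((hu.norm_sq.const_sub 1).fun_pow 2).div_const 2)
  refine (henergy.congr_deriv ?_).congr_of_eventuallyEq ?_
  · have hquot : ∀ a m D : ℝ, D ≠ 0 → (2 * κ * (2 * (D * m) * a) * D
        - 2 * κ * (D * m) ^ 2 * -(2 * κ * (2 * m))) / D ^ 2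
          = 4 * κ * m * a + 8 * κ ^ 2 * m ^ 3 := fun a m D hD => by
      field_simp
      ring
    simp only [Nat.cast_ofNat, Nat.add_one_sub_one, pow_one]
    rw [inner_neg_right, inner_neg_right, inner_flux_forcing, inner_deriv_flux,
      inner_flux_self, hquot _ _ _ (hne x hx)]
    ring
  · filter_upwards [hs.mem_nhds hx] with y hy
    have := hne y hy
    rw [inner_flux_self, norm_sq_flux]
    field_simp
    ring

end IsClassicalSolutionOn

theorem exists_seq_tendsto_zero_of_integrableOn_Ioi {f : ℝ → ℝ} (hf : IntegrableOn f (Set.Ioi 0))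
    (hf0 : ∀ x, 0 ≤ f x) :
    ∃ x : ℕ → ℝ, (∀ n, 0 < x n) ∧ Filter.Tendsto (fun n => f (x n)) Filter.atTop (𝓝 0) := by
  have hexists : ∀ n : ℕ, ∃ x, 0 < x ∧ f x < 1 / ((n : ℝ) + 1) := fun n => by
    by_contra! hle
    have hconst : IntegrableOn (fun _ : ℝ => 1 / ((n : ℝ) + 1)) (Set.Ioi 0) := by
      refine hf.mono' aestronglyMeasurable_const ?_
      filter_upwards [ae_restrict_mem measurableSet_Ioi] with x hx
      rw [Real.norm_of_nonneg (by positivity)]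
      exact hle x hx
    rw [integrableOn_const_iff] at hconst
    simp [(Nat.cast_add_one_pos n).ne'] at hconst
  choose x hx0 hx using hexists
  exact ⟨x, hx0, squeeze_zero (fun n => hf0 _) (fun n => (hx n).le)
    tendsto_one_div_add_atTop_nhds_zero_nat⟩

theorem exists_seq_tendsto_zero_of_memLp {E F : Type*} [NormedAddCommGroup E]
    [NormedAddCommGroup F] {f : ℝ → E} {g : ℝ → F} (hf : MemLp f 2 (volume.restrict (Set.Ioi 0)))
    (hg : MemLp g 2 (volume.restrict (Set.Ioi 0))) :
    ∃ x : ℕ → ℝ, (∀ n, 0 < x n) ∧ Filter.Tendsto (fun n => f (x n)) Filter.atTop (𝓝 0) ∧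
      Filter.Tendsto (fun n => g (x n)) Filter.atTop (𝓝 0) := by
  obtain ⟨x, hx, hlim⟩ := exists_seq_tendsto_zero_of_integrableOn_Ioi
    (((memLp_two_iff_integrable_sq_norm hf.1).1 hf).add
      ((memLp_two_iff_integrable_sq_norm hg.1).1 hg))
    fun x => add_nonneg (sq_nonneg ‖f x‖) (sq_nonneg ‖g x‖)
  have hsqrt := hlim.sqrt
  rw [Real.sqrt_zero] at hsqrt
  exact ⟨x, hx,
    squeeze_zero_norm (fun n => Real.le_sqrt_of_sq_le (le_add_of_nonneg_right (sq_nonneg _))) hsqrt,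
    squeeze_zero_norm (fun n => Real.le_sqrt_of_sq_le (le_add_of_nonneg_left (sq_nonneg _))) hsqrt⟩

theorem eq_zero_of_hasDerivAt_zero_Ioi {f : ℝ → ℝ} {a : ℕ → ℝ}
    (hf : ∀ x ∈ Set.Ioi 0, HasDerivAt f 0 x) (ha : ∀ n, 0 < a n)
    (hlim : Filter.Tendsto (fun n => f (a n)) Filter.atTop (𝓝 0)) (hx : x ∈ Set.Ioi 0) :
    f x = 0 := by
  have hconst : ∀ n, f (a n) = f x := fun n =>
    isOpen_Ioi.is_const_of_deriv_eq_zero (𝕜 := ℝ) isPreconnected_Ioi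
      (fun z hz => (hf z hz).differentiableAt.differentiableWithinAt)
      (fun z hz => (hf z hz).deriv) (ha n) hx
  simp only [hconst] at hlim
  exact tendsto_nhds_unique tendsto_const_nhds hlim

theorem tendsto_inner_of_tendsto_norm_sq {a : ℕ → ℝ} {z : ℝ → ℂ}
    (hu : Filter.Tendsto (fun n => 1 - ‖u (a n)‖ ^ 2) Filter.atTop (𝓝 0))
    (hv : Filter.Tendsto (fun n => v (a n)) Filter.atTop (𝓝 0)) (hz : ∀ x, ‖z x‖ = ‖u x‖) :
    Filter.Tendsto (fun n => inner ℝ (z (a n)) (v (a n))) Filter.atTop (𝓝 0) := by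
  have hnorm := ((hu.const_sub 1).sqrt).mul hv.norm
  simp only [sub_sub_cancel, Real.sqrt_sq (norm_nonneg _), norm_zero, mul_zero] at hnorm
  exact squeeze_zero_norm (fun n => hz (a n) ▸ norm_inner_le_norm _ _) hnorm

variable (h : IsClassicalSolutionOn c κ (Set.Ioi 0) u v)
  (hu : MemLp (fun x => 1 - ‖u x‖ ^ 2) 2 (volume.restrict (Set.Ioi 0)))
  (hv : MemLp v 2 (volume.restrict (Set.Ioi 0)))

include h hu hv

theorem IsClassicalSolutionOn.inner_I_mul_eq (hx : x ∈ Set.Ioi 0) :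
    inner ℝ (Complex.I * u x) (v x) = c / 2 * (1 - ‖u x‖ ^ 2) := by
  obtain ⟨a, ha, hua, hva⟩ := exists_seq_tendsto_zero_of_memLp hu hv
  have hmomentum := (tendsto_inner_of_tendsto_norm_sq (z := fun x => Complex.I * u x) hua hva
    fun x => by rw [norm_mul, Complex.norm_I, one_mul]).sub (hua.const_mul (c / 2))
  rw [mul_zero, sub_zero] at hmomentum
  have hzero := eq_zero_of_hasDerivAt_zero_Ioi (fun _ => h.hasDerivAt_momentum) ha hmomentum hx
  exact sub_eq_zero.1 hzero

theorem IsClassicalSolutionOn.norm_sq_deriv_eq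
    (hne : ∀ y ∈ Set.Ioi 0, 1 - 2 * κ * ‖u y‖ ^ 2 ≠ 0) (hx : x ∈ Set.Ioi 0) :
    ‖v x‖ ^ 2 - 2 * κ * inner ℝ (u x) (v x) ^ 2 = (1 - ‖u x‖ ^ 2) ^ 2 / 2 := by
  obtain ⟨a, ha, hua, hva⟩ := exists_seq_tendsto_zero_of_memLp hu hv
  have henergy := ((hva.norm.pow 2).sub (((tendsto_inner_of_tendsto_norm_sq hua hva
    fun _ => rfl).pow 2).const_mul (2 * κ))).sub ((hua.pow 2).div_const 2)
  simp only [norm_zero, zero_pow two_ne_zero, mul_zero, zero_div, sub_zero] at henergy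
  have hzero := eq_zero_of_hasDerivAt_zero_Ioi
    (fun _ => h.hasDerivAt_energy isOpen_Ioi hne) ha henergy hx
  exact sub_eq_zero.1 hzero

end FirstIntegrals

/-! ### The profile equation on a half-line -/

theorem pos_of_isPreconnected_of_ne_zero {s : Set ℝ} {f : ℝ → ℝ} {a x : ℝ}
    (hs : IsPreconnected s) (hf : ContinuousOn f s) (hne : ∀ y ∈ s, f y ≠ 0) (ha : a ∈ s)
    (hpos : 0 < f a) (hx : x ∈ s) : 0 < f x := by
  by_contra hle
  obtain ⟨y, hy, hzero⟩ := hs.intermediate_value hx ha hf ⟨not_lt.1 hle, hpos.le⟩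
  exact hne y hy hzero

theorem eq_zero_of_abs_deriv_le_mul_abs_self_of_eq_zero_left {f f' : ℝ → ℝ} {K a b : ℝ}
    (hf : ∀ x ∈ Set.Icc a b, HasDerivAt f (f' x) x) (hb : f b = 0)
    (hbound : ∀ x ∈ Set.Icc a b, |f' x| ≤ K * |f x|) : ∀ x ∈ Set.Icc a b, f x = 0 := by
  have hmem : ∀ {x}, x ∈ Set.Icc (-b) (-a) → -x ∈ Set.Icc a b := fun hx =>
    ⟨le_neg.1 hx.2, neg_le.1 hx.1⟩
  have hderiv : ∀ x ∈ Set.Icc (-b) (-a), HasDerivAt (fun y => f (-y)) (-f' (-x)) x :=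
    fun x hx => by simpa [Function.comp_def] using (hf _ (hmem hx)).scomp x (hasDerivAt_neg x)
  intro x hx
  rw [← neg_neg x]
  exact eq_zero_of_abs_deriv_le_mul_abs_self_of_eq_zero_right (f := fun y => f (-y))
    (f' := fun y => -f' (-y)) (K := K)
    (fun y hy => (hderiv y hy).continuousAt.continuousWithinAt)
    (fun y hy => (hderiv y (Set.Ico_subset_Icc_self hy)).hasDerivWithinAt)
    (by rw [neg_neg, hb])
    (fun y hy => by
      rw [norm_neg]
      exact hbound _ (hmem (Set.Ico_subset_Icc_self hy)))
    (-x) ⟨neg_le_neg hx.2, neg_le_neg hx.1⟩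

theorem hasDerivAt_indexOfValue {κ A y : ℝ} (hκ : 0 < κ) (hκ' : κ ≠ 1 / 2) (hA : 0 ≤ A)
    (hy : y ∈ profileRange κ) (ht : 0 < indexOfValue κ A y) :
    HasDerivAt (indexOfValue κ A) ((κ + indexOfValue κ A y ^ 2)
      / (indexOfValue κ A y * ((1 - 2 * κ) * A - 2 * y))) y := by
  have hsq := indexOfValue_sq_mul hκ hκ' hA hy
  have hnumer : (1 - 2 * κ) * A - 2 * y ≠ 0 := right_ne_zero_of_mul
    (indexOfValue_numer_pos hA ((mem_profileRange_iff hκ hκ').1 hy).1).ne'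
  have hquot := (((hasDerivAt_id y).const_mul (2 * κ)).const_add (1 - 2 * κ)).fun_div
    (((hasDerivAt_id y).const_mul 2).const_sub ((1 - 2 * κ) * A)) hnumer
  refine (hquot.sqrt (Real.sqrt_pos.1 ht).ne').congr_deriv ?_
  simp only [id_eq]
  rw [← indexOfValue]
  have := ht.ne'
  field_simp
  linear_combination -hsq

/-- The profile equation for `η = 1 - |u|²` and `e = η'` on the half-line `(0, ∞)`, for an `η` that
is singular exactly at the origin and does not stay away from zero. -/
structure IsProfileSolution (κ A : ℝ) (η e : ℝ → ℝ) : Prop where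
  continuous : Continuous η
  continuousOn_deriv : ContinuousOn e (Set.Ioi 0)
  hasDerivAt : ∀ x, 0 < x → HasDerivAt η (e x) x
  sq_deriv_mul : ∀ x, 0 < x →
    e x ^ 2 * (1 - 2 * κ + 2 * κ * η x) = η x ^ 2 * ((1 - 2 * κ) * A - 2 * η x)
  denom_zero : 1 - 2 * κ + 2 * κ * η 0 = 0
  denom_ne_zero : ∀ x, 0 < x → 1 - 2 * κ + 2 * κ * η x ≠ 0
  exists_abs_lt : ∀ ε > 0, ∃ x, 0 < x ∧ |η x| < ε

namespace IsProfileSolution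

variable {κ A x : ℝ} {η e : ℝ → ℝ}

theorem denom_pos (h : IsProfileSolution κ A η e) (hκ : 0 < κ) (hκ' : κ ≠ 1 / 2) (hx : 0 < x) :
    0 < (1 - 2 * κ) * (1 - 2 * κ + 2 * κ * η x) := by
  have hκ'' := one_sub_two_mul_ne_zero hκ'
  obtain ⟨a, ha, hsmall⟩ := h.exists_abs_lt (|1 - 2 * κ| / (2 * κ)) (by positivity)
  have := h.continuous
  refine pos_of_isPreconnected_of_ne_zero (f := fun x => (1 - 2 * κ) * (1 - 2 * κ + 2 * κ * η x))
    isPreconnected_Ioi (by fun_prop) (fun y hy => mul_ne_zero hκ'' (h.denom_ne_zero y hy)) ha ?_ hx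
  have hlt : |(1 - 2 * κ) * (2 * κ * η a)| < (1 - 2 * κ) ^ 2 := by
    rw [lt_div_iff₀ (by positivity)] at hsmall
    rw [abs_mul, abs_mul, abs_of_pos (show 0 < 2 * κ by positivity), ← sq_abs, sq, mul_comm (2 * κ)]
    exact mul_lt_mul_of_pos_left hsmall (abs_pos.2 hκ'')
  linarith [neg_abs_le ((1 - 2 * κ) * (2 * κ * η a))]

theorem apply_zero_ne_zero (h : IsProfileSolution κ A η e) (hκ' : κ ≠ 1 / 2) : η 0 ≠ 0 := by
  intro hzero
  have hdenom := h.denom_zero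
  rw [hzero, mul_zero, add_zero] at hdenom
  exact one_sub_two_mul_ne_zero hκ' hdenom

theorem exists_abs_deriv_le (h : IsProfileSolution κ A η e) {a b : ℝ} (ha : 0 < a) :
    ∃ K, ∀ x ∈ Set.Icc a b, |e x| ≤ K * |η x| := by
  have hpos : ∀ x ∈ Set.Icc a b, 0 < x := fun x hx => ha.trans_le hx.1
  have := h.continuous
  have hcont : ContinuousOn
      (fun x => ((1 - 2 * κ) * A - 2 * η x) / (1 - 2 * κ + 2 * κ * η x)) (Set.Icc a b) :=
    ContinuousOn.div (by fun_prop) (by fun_prop) fun x hx => h.denom_ne_zero x (hpos x hx)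
  obtain ⟨K, hK⟩ := isCompact_Icc.exists_bound_of_continuousOn hcont
  refine ⟨√K, fun x hx => ?_⟩
  have := h.denom_ne_zero x (hpos x hx)
  have hsq : e x ^ 2
      = ((1 - 2 * κ) * A - 2 * η x) / (1 - 2 * κ + 2 * κ * η x) * η x ^ 2 := by
    rw [div_mul_eq_mul_div, eq_div_iff this, h.sq_deriv_mul x (hpos x hx), mul_comm]
  rw [← Real.sqrt_sq_eq_abs, ← Real.sqrt_sq_eq_abs,
    ← Real.sqrt_mul ((norm_nonneg _).trans (hK x hx)), hsq]
  gcongr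
  exact (le_abs_self _).trans (hK x hx)

/-- At a zero the equation is locally Lipschitz, so `η` would vanish on all of `(0, x]` and, by
continuity, at the origin. -/
theorem apply_ne_zero (h : IsProfileSolution κ A η e) (hκ' : κ ≠ 1 / 2) (hx : 0 ≤ x) :
    η x ≠ 0 := by
  intro hzero
  rcases hx.eq_or_lt with rfl | hx
  · exact h.apply_zero_ne_zero hκ' hzero
  have heq : Set.EqOn η 0 (Set.Ioo 0 x) := fun a ha => by
    obtain ⟨K, hK⟩ := h.exists_abs_deriv_le (b := x) ha.1
    exact eq_zero_of_abs_deriv_le_mul_abs_self_of_eq_zero_left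
      (fun y hy => h.hasDerivAt y (ha.1.trans_le hy.1)) hzero hK a (Set.left_mem_Icc.2 ha.2.le)
  refine h.apply_zero_ne_zero hκ' (heq.closure h.continuous continuous_zero ?_)
  rw [closure_Ioo hx.ne]
  exact Set.left_mem_Icc.2 hx.le

theorem apply_mem_profileRange (h : IsProfileSolution κ A η e) (hκ : 0 < κ) (hκ' : κ ≠ 1 / 2)
    (hx : 0 ≤ x) : η x ∈ profileRange κ := by
  have hκ'' := one_sub_two_mul_ne_zero hκ'
  have := h.continuous
  have hzero : 0 < -((1 - 2 * κ) * η 0) := by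
    refine pos_of_mul_pos_right (a := 2 * κ) ?_ (by positivity)
    calc 0 < (1 - 2 * κ) ^ 2 := by positivity
      _ = 2 * κ * -((1 - 2 * κ) * η 0) := by linear_combination (1 - 2 * κ) * h.denom_zero
  have hneg := pos_of_isPreconnected_of_ne_zero (f := fun x => -((1 - 2 * κ) * η x))
    isPreconnected_Ici (by fun_prop)
    (fun y hy => neg_ne_zero.2 (mul_ne_zero hκ'' (h.apply_ne_zero hκ' hy)))
    Set.self_mem_Ici hzero hx
  refine (mem_profileRange_iff hκ hκ').2 ⟨neg_pos.1 hneg, ?_⟩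
  rcases hx.eq_or_lt with rfl | hx
  · rw [h.denom_zero, mul_zero]
  · exact (h.denom_pos hκ hκ' hx).le

theorem indexOfValue_apply_zero (h : IsProfileSolution κ A η e) : indexOfValue κ A (η 0) = 0 := by
  rw [indexOfValue, h.denom_zero, zero_div, Real.sqrt_zero]

theorem indexOfValue_apply_pos (h : IsProfileSolution κ A η e) (hκ : 0 < κ) (hκ' : κ ≠ 1 / 2)
    (hA : 0 ≤ A) (hx : 0 < x) : 0 < indexOfValue κ A (η x) := by
  refine (Real.sqrt_nonneg _).lt_of_ne' fun hzero => h.denom_ne_zero x hx ?_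
  rw [← indexOfValue_sq_mul hκ hκ' hA (h.apply_mem_profileRange hκ hκ' hx.le), indexOfValue, hzero]
  ring

theorem continuousOn_indexOfValue_apply (h : IsProfileSolution κ A η e) (hκ : 0 < κ)
    (hκ' : κ ≠ 1 / 2) (hA : 0 ≤ A) :
    ContinuousOn (fun x => indexOfValue κ A (η x)) (Set.Ici 0) := by
  have := h.continuous
  refine (ContinuousOn.div (by fun_prop) (by fun_prop) fun x hx => right_ne_zero_of_mul
    (indexOfValue_numer_pos hA ?_).ne').sqrt
  exact ((mem_profileRange_iff hκ hκ').1 (h.apply_mem_profileRange hκ hκ' hx)).1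

theorem sq_deriv_mul_index (h : IsProfileSolution κ A η e) (hκ : 0 < κ) (hκ' : κ ≠ 1 / 2)
    (hA : 0 ≤ A) (hx : 0 < x) : (e x * indexOfValue κ A (η x)) ^ 2 = η x ^ 2 := by
  have hmem := h.apply_mem_profileRange hκ hκ' hx.le
  refine mul_right_cancel₀ (right_ne_zero_of_mul
    (indexOfValue_numer_pos hA ((mem_profileRange_iff hκ hκ').1 hmem).1).ne') ?_
  rw [mul_pow, mul_assoc, indexOfValue_sq_mul hκ hκ' hA hmem, h.sq_deriv_mul x hx]

/-- The other sign would make `η²` strictly increasing, hence bounded away from zero. -/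
theorem deriv_mul_index (h : IsProfileSolution κ A η e) (hκ : 0 < κ) (hκ' : κ ≠ 1 / 2)
    (hA : 0 ≤ A) (hx : 0 < x) : e x * indexOfValue κ A (η x) = -η x := by
  have hsign := isPreconnected_Ioi.eq_or_eq_neg_of_sq_eq
    (h.continuousOn_deriv.mul
      ((h.continuousOn_indexOfValue_apply hκ hκ' hA).mono Set.Ioi_subset_Ici_self))
    h.continuous.continuousOn (fun y hy => h.sq_deriv_mul_index hκ hκ' hA hy)
    fun hy => h.apply_ne_zero hκ' (Set.mem_Ioi.1 hy).le
  refine (hsign.resolve_left fun hplus => ?_) hx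
  have := h.continuous
  have hmono : StrictMonoOn (fun y => η y ^ 2) (Set.Ici 0) := by
    refine strictMonoOn_of_deriv_pos (convex_Ici 0) (by fun_prop) fun y hy => ?_
    rw [interior_Ici] at hy
    have hindex := h.indexOfValue_apply_pos hκ hκ' hA hy
    have hpos : 0 < η y * e y * indexOfValue κ A (η y) := by
      rw [mul_assoc, show e y * indexOfValue κ A (η y) = η y from hplus hy]
      exact mul_self_pos.2 (h.apply_ne_zero hκ' (Set.mem_Ioi.1 hy).le)
    rw [((h.hasDerivAt y hy).fun_pow 2).deriv]
    simpa [mul_assoc] using pos_of_mul_pos_left hpos hindex.le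
  obtain ⟨a, ha, hsmall⟩ := h.exists_abs_lt |η 0| (abs_pos.2 (h.apply_zero_ne_zero hκ'))
  exact (sq_lt_sq.1 (hmono Set.self_mem_Ici (Set.mem_Ici.2 ha.le) ha)).not_gt hsmall

theorem hasDerivAt_travelTime_index (h : IsProfileSolution κ A η e) (hκ : 0 < κ) (hκ' : κ ≠ 1 / 2)
    (hA : 0 ≤ A) (hx : 0 < x) :
    HasDerivAt (fun y => travelTime κ A (indexOfValue κ A (η y))) 1 x := by
  have hmem := h.apply_mem_profileRange hκ hκ' hx.le
  have hindex := indexOfValue_mem hκ hκ' hA hmem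
  have hpos := h.indexOfValue_apply_pos hκ hκ' hA hx
  have hderiv : e x = -η x / indexOfValue κ A (η x) := by
    rw [eq_div_iff hpos.ne', h.deriv_mul_index hκ hκ' hA hx]
  have hnumer := profileValue_numer hκ A (indexOfValue κ A (η x))
  have hvalue := profileValue_indexOfValue hκ hκ' hA hmem
  rw [hvalue] at hnumer
  refine ((hasDerivAt_travelTime hκ hA hindex).comp x
    ((hasDerivAt_indexOfValue hκ hκ' hA hmem hpos).comp x (h.hasDerivAt x hx))).congr_deriv ?_
  rw [hnumer, hderiv]
  nth_rw 7 [← hvalue]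
  rw [profileValue]
  have hdenom := (one_sub_pos_of_mem_indexDomain hindex).ne'
  rw [mul_comm A] at hdenom
  have := one_sub_two_mul_ne_zero hκ'
  generalize indexOfValue κ A (η x) = t at *
  have : κ + t ^ 2 ≠ 0 := by positivity
  field_simp
  ring

theorem eq_profileValue (h : IsProfileSolution κ A η e) (hκ : 0 < κ) (hκ' : κ ≠ 1 / 2)
    (hA : 0 ≤ A) (hx : 0 < x) : η x = profileValue κ A (travelIndex κ A x) := by
  have hindex : ∀ y, 0 ≤ y → indexOfValue κ A (η y) ∈ indexDomain A := fun y hy =>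
    indexOfValue_mem hκ hκ' hA (h.apply_mem_profileRange hκ hκ' hy)
  have hcont : ContinuousOn (fun y => travelTime κ A (indexOfValue κ A (η y))) (Set.Icc 0 x) :=
    (continuousOn_travelTime hκ hA).comp
      ((h.continuousOn_indexOfValue_apply hκ hκ' hA).mono Set.Icc_subset_Ici_self)
      fun y hy => hindex y hy.1
  obtain ⟨-, -, hslope⟩ := exists_hasDerivAt_eq_slope _ (fun _ => 1) hx hcont
    fun y hy => h.hasDerivAt_travelTime_index hκ hκ' hA hy.1
  have htime : travelTime κ A (indexOfValue κ A (η x)) = x := by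
    rw [h.indexOfValue_apply_zero, travelTime_zero hA, sub_zero, sub_zero,
      eq_div_iff hx.ne', one_mul] at hslope
    exact hslope.symm
  rw [← profileValue_indexOfValue hκ hκ' hA (h.apply_mem_profileRange hκ hκ' hx.le)]
  congr 1
  rw [← travelIndex_travelTime hκ hA (hindex x hx.le), htime]

end IsProfileSolution

/-! ### Uniqueness up to a phase -/

theorem speedRatio_neg (c κ : ℝ) : speedRatio (-c) κ = speedRatio c κ := by
  rw [speedRatio, speedRatio, neg_sq]

theorem cuspProfile_neg (c κ x : ℝ) : cuspProfile c κ (-x) = cuspProfile c κ x := by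
  rw [cuspProfile, cuspProfile, abs_neg]

theorem memLp_comp_neg {E : Type*} [NormedAddCommGroup E] {f : ℝ → E} (hf : MemLp f 2) :
    MemLp (fun x => f (-x)) 2 :=
  hf.comp_measurePreserving (Measure.measurePreserving_neg volume)

theorem conj_mul_eq (z w : ℂ) : (starRingEnd ℂ) z * w
    = ((inner ℝ z w : ℝ) : ℂ) + Complex.I * ((inner ℝ (Complex.I * z) w : ℝ) : ℂ) := by
  rw [inner_eq_re_mul_re_add_im_mul_im, inner_eq_re_mul_re_add_im_mul_im, Complex.I_mul_re,
    Complex.I_mul_im]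
  refine Complex.ext ?_ ?_ <;>
    simp only [Complex.mul_re, Complex.mul_im, Complex.add_re, Complex.add_im, Complex.conj_re,
      Complex.conj_im, Complex.ofReal_re, Complex.ofReal_im, Complex.I_re, Complex.I_im] <;>
    ring

theorem eq_logDeriv_mul {a b : ℝ} {z w : ℂ} (hz : z ≠ 0) (hre : inner ℝ z w = a * ‖z‖ ^ 2)
    (him : inner ℝ (Complex.I * z) w = b * ‖z‖ ^ 2) : w = (a + Complex.I * b) * z := by
  refine mul_left_cancel₀ ((map_ne_zero (starRingEnd ℂ)).2 hz) ?_
  rw [conj_mul_eq, hre, him, mul_left_comm, Complex.conj_mul']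
  push_cast
  ring

theorem eq_const_of_hasDerivAt_zero_of_ne {E : Type*} [NormedAddCommGroup E] [NormedSpace ℝ E]
    {f : ℝ → E} {a : ℝ} (hf : Continuous f) (hderiv : ∀ x, x ≠ a → HasDerivAt f 0 x) (x y : ℝ) :
    f x = f y := by
  have hderiv' : ∀ x, HasDerivAt f 0 x := fun x => by
    rcases eq_or_ne x a with rfl | hx
    · exact hasDerivAt_of_hasDerivAt_of_ne (g := fun _ => 0) hderiv hf.continuousAt
        continuousAt_const
    · exact hderiv x hx
  exact is_const_of_deriv_eq_zero (fun x => (hderiv' x).differentiableAt)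
    (fun x => (hderiv' x).deriv) x y

section Uniqueness

variable {c κ x : ℝ} {u v : ℝ → ℂ}

theorem IsClassicalSolutionOn.isProfileSolution (h : IsClassicalSolutionOn c κ (Set.Ioi 0) u v)
    (hκ' : κ ≠ 1 / 2) (huc : Continuous u)
    (hu : MemLp (fun x => 1 - ‖u x‖ ^ 2) 2 (volume.restrict (Set.Ioi 0)))
    (hv : MemLp v 2 (volume.restrict (Set.Ioi 0))) (hzero : 1 - 2 * κ * ‖u 0‖ ^ 2 = 0)
    (hne : ∀ y ∈ Set.Ioi 0, 1 - 2 * κ * ‖u y‖ ^ 2 ≠ 0) :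
    IsProfileSolution κ (speedRatio c κ) (fun x => 1 - ‖u x‖ ^ 2)
      (fun x => -(2 * inner ℝ (u x) (v x))) where
  continuous := by fun_prop
  continuousOn_deriv := ((huc.continuousOn.inner h.continuousOn).const_mul 2).neg
  hasDerivAt x hx := (h.hasDerivAt x hx).norm_sq.const_sub 1
  sq_deriv_mul x hx := by
    have henergy := h.norm_sq_deriv_eq hu hv hne hx
    have hmodulus := norm_sq_mul_norm_sq_eq (u x) (v x)
    rw [h.inner_I_mul_eq hu hv hx] at hmodulus
    rw [speedRatio, mul_div_cancel₀ _ (one_sub_two_mul_ne_zero hκ')]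
    linear_combination 4 * ‖u x‖ ^ 2 * henergy - 4 * hmodulus
  denom_zero := by linear_combination hzero
  denom_ne_zero x hx := by
    convert hne x hx using 1
    ring
  exists_abs_lt ε hε := by
    obtain ⟨a, ha, hlim, -⟩ := exists_seq_tendsto_zero_of_memLp hu hv
    obtain ⟨n, hn⟩ := (hlim.abs.eventually (gt_mem_nhds (by simpa using hε))).exists
    exact ⟨a n, ha n, hn⟩

variable (hparam : IsCuspParam c κ) (h : IsClassicalSolutionOn c κ {0}ᶜ u v) (huc : Continuous u)
  (hu : MemLp (fun x => 1 - ‖u x‖ ^ 2) 2) (hv : MemLp v 2) (hsing : singularSet κ u = {0})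

include h hu hv in
theorem IsClassicalSolutionOn.inner_I_mul_eq_of_ne (hx : x ≠ 0) :
    inner ℝ (Complex.I * u x) (v x) = c / 2 * (1 - ‖u x‖ ^ 2) := by
  rcases hx.lt_or_gt with hx | hx
  · have hneg := (h.comp_neg fun y hy => neg_ne_zero.2 (ne_of_gt hy)).inner_I_mul_eq
      ((memLp_comp_neg hu).restrict _) ((memLp_comp_neg hv).neg.restrict _)
      (Set.mem_Ioi.2 (neg_pos.2 hx))
    rw [neg_neg, inner_neg_right] at hneg
    linear_combination -hneg
  · exact (h.mono fun y hy => ne_of_gt hy).inner_I_mul_eq (hu.restrict _) (hv.restrict _) hx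

include hparam h huc hu hv hsing

theorem IsClassicalSolutionOn.norm_sq_eq_norm_sq_cuspon (x : ℝ) :
    ‖u x‖ ^ 2 = ‖cuspon c κ x‖ ^ 2 := by
  have hκ := hparam.kappa_pos
  have hsing' : ∀ y, 1 - 2 * κ * ‖u y‖ ^ 2 ≠ 0 ↔ y ≠ 0 := fun y => by
    rw [one_sub_ne_zero_iff_notMem_singularSet hκ, hsing, Set.mem_singleton_iff]
  have hzero : 1 - 2 * κ * ‖u 0‖ ^ 2 = 0 := not_not.1 (mt (hsing' 0).1 (by simp))
  have hpos := (h.mono fun y hy => ne_of_gt hy).isProfileSolution hparam.kappa_ne_half huc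
    (hu.restrict _) (hv.restrict _) hzero fun y hy => (hsing' y).2 (ne_of_gt hy)
  have hneg := (h.comp_neg fun y hy => neg_ne_zero.2 (ne_of_gt hy)).isProfileSolution
    hparam.kappa_ne_half (huc.comp continuous_neg) ((memLp_comp_neg hu).restrict _)
    ((memLp_comp_neg hv).neg.restrict _)
    (by rwa [neg_zero]) fun y hy => (hsing' (-y)).2 (neg_ne_zero.2 (ne_of_gt hy))
  rw [speedRatio_neg] at hneg
  have hvalue : ∀ {η e : ℝ → ℝ}, IsProfileSolution κ (speedRatio c κ) η e → ∀ y, 0 < y →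
      η y = cuspProfile c κ y := fun hη y hy => by
    rw [hη.eq_profileValue hκ hparam.kappa_ne_half hparam.speedRatio_nonneg hy,
      hparam.cuspProfile_eq, cuspIndex]
  rw [hparam.norm_sq_cuspon]
  rcases lt_trichotomy x 0 with hx | rfl | hx
  · have := hvalue hneg (-x) (neg_pos.2 hx)
    rw [neg_neg, cuspProfile_neg] at this
    rw [← this, sub_sub_cancel]
  · have hcuspon : (0 : ℝ) ∈ singularSet κ (cuspon c κ) := hparam.singularSet_cuspon ▸ rfl
    have hu0 : (0 : ℝ) ∈ singularSet κ u := hsing ▸ rfl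
    rw [← hparam.norm_sq_cuspon]
    exact hu0.trans hcuspon.symm
  · rw [← hvalue hpos x hx, sub_sub_cancel]

theorem IsClassicalSolutionOn.deriv_eq_logDeriv_mul (hx : x ≠ 0) :
    v x = ((cuspRatio c κ x / (2 * cuspIndex c κ x) : ℝ)
      + Complex.I * (c / 2 * cuspRatio c κ x : ℝ)) * u x := by
  have hnorm : ∀ y, ‖u y‖ ^ 2 = 1 - cuspProfile c κ y := fun y => by
    rw [h.norm_sq_eq_norm_sq_cuspon hparam huc hu hv hsing, hparam.norm_sq_cuspon]
  have hratio := hparam.cuspRatio_mul x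
  have hne : u x ≠ 0 := fun hzero => by
    have := hparam.one_sub_cuspProfile_pos x
    rw [← hnorm, hzero] at this
    simp at this
  have hderiv : 2 * inner ℝ (u x) (v x) = cuspProfile c κ x / cuspIndex c κ x := by
    have := (h.hasDerivAt x hx).norm_sq
    rw [funext hnorm] at this
    simpa using this.unique ((hparam.hasDerivAt_cuspProfile hx).const_sub 1)
  refine eq_logDeriv_mul hne ?_ ?_
  · rw [hnorm, div_mul_eq_mul_div, hratio]
    linear_combination hderiv / 2
  · rw [h.inner_I_mul_eq_of_ne hu hv hx, hnorm, mul_assoc, hratio, sub_sub_cancel]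

theorem IsClassicalSolutionOn.exists_phase :
    ∃ φ : ℝ, ∀ x, u x = Complex.exp (Complex.I * (φ : ℂ)) * cuspon c κ x := by
  have hcuspon := hparam.cuspon_ne_zero
  have hconst := eq_const_of_hasDerivAt_zero_of_ne (f := fun x => u x / cuspon c κ x)
    (huc.div hparam.continuous_cuspon hcuspon) (a := 0) fun x hx => by
      refine ((h.hasDerivAt x hx).fun_div (hparam.hasDerivAt_cuspon hx) (hcuspon x)).congr_deriv ?_
      rw [h.deriv_eq_logDeriv_mul hparam huc hu hv hsing hx, cusponDeriv, div_eq_zero_iff]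
      left
      ring
  have hnorm : ‖u 0 / cuspon c κ 0‖ = 1 := by
    rw [norm_div, div_eq_one_iff_eq (norm_ne_zero_iff.2 (hcuspon 0)),
      ← sq_eq_sq₀ (norm_nonneg _) (norm_nonneg _)]
    exact h.norm_sq_eq_norm_sq_cuspon hparam huc hu hv hsing 0
  refine ⟨(u 0 / cuspon c κ 0).arg, fun x => ?_⟩
  have hphase := Complex.norm_mul_exp_arg_mul_I (u 0 / cuspon c κ 0)
  rw [hnorm, Complex.ofReal_one, one_mul, mul_comm _ Complex.I] at hphase
  rw [hphase, ← hconst x 0, div_mul_cancel₀ _ (hcuspon x)]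

end Uniqueness

namespace IsCuspParam

variable {c κ : ℝ}

theorem not_differentiableAt_cuspProfile_zero (h : IsCuspParam c κ) :
    ¬ DifferentiableAt ℝ (cuspProfile c κ) 0 := by
  have hprofile : cuspProfile c κ 0 ≠ 0 := fun hzero => by
    have hdenom := h.cuspProfile_denom 0
    rw [h.cuspIndex_eq_zero_iff.2 rfl, hzero, sq, zero_mul, zero_mul, mul_zero, add_zero] at hdenom
    exact one_sub_two_mul_ne_zero h.kappa_ne_half hdenom
  have hindex : Filter.Tendsto (fun x => (cuspIndex c κ x)⁻¹) (𝓝[>] 0) Filter.atTop := by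
    refine tendsto_inv_nhdsGT_zero.comp (tendsto_nhdsWithin_iff.2 ⟨?_, ?_⟩)
    · simpa only [h.cuspIndex_eq_zero_iff.2 rfl] using
        (h.continuous_cuspIndex.tendsto 0).mono_left nhdsWithin_le_nhds
    · filter_upwards [self_mem_nhdsWithin] with x hx
      exact travelIndex_pos h.kappa_pos h.speedRatio_nonneg hx
  have hlim : Filter.Tendsto (fun x => -cuspProfile c κ x) (𝓝[>] 0) (𝓝 (-cuspProfile c κ 0)) :=
    (h.continuous_cuspProfile.neg.tendsto 0).mono_left nhdsWithin_le_nhds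
  have hderiv : (fun x => -cuspProfile c κ x * (cuspIndex c κ x)⁻¹)
      =ᶠ[𝓝[>] 0] deriv (cuspProfile c κ) := by
    filter_upwards [self_mem_nhdsWithin] with x hx
    rw [(h.hasDerivAt_cuspProfile (ne_of_gt hx)).deriv, div_eq_mul_inv, neg_mul]
  intro hdiff
  rcases hprofile.lt_or_gt with hneg | hpos
  · exact not_differentiableWithinAt_of_deriv_tendsto_atTop_Ioi _
      ((hlim.pos_mul_atTop (neg_pos.2 hneg) hindex).congr' hderiv) hdiff.differentiableWithinAt
  · exact not_differentiableWithinAt_of_deriv_tendsto_atBot_Ioi _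
      ((hlim.neg_mul_atTop (neg_neg_of_pos hpos) hindex).congr' hderiv)
      hdiff.differentiableWithinAt

theorem nonDiffSet_const_mul_cuspon (h : IsCuspParam c κ) {z : ℂ} (hz : z ≠ 0) :
    nonDiffSet (fun x => z * cuspon c κ x) = {0} := by
  ext x
  rw [nonDiffSet, Set.mem_ofPred_eq, Set.mem_singleton_iff, not_iff_comm]
  refine ⟨fun hx => ((h.hasDerivAt_cuspon hx).const_mul z).differentiableAt, ?_⟩
  rintro hdiff rfl
  refine h.not_differentiableAt_cuspProfile_zero ?_
  have hcuspon : DifferentiableAt ℝ (cuspon c κ) 0 := by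
    simpa only [inv_mul_cancel_left₀ hz] using hdiff.const_mul z⁻¹
  simpa only [h.norm_sq_cuspon, sub_sub_cancel] using (hcuspon.norm_sq ℝ).const_sub 1

end IsCuspParam

theorem corollary1p4_general {c κ : ℝ} (h : IsCuspParam c κ) :
    Set.BijOn (cuspFun c κ) (profileRange κ) (Set.Ici 0) ∧
    (MemEnergySpace (cuspon c κ) ∧ IsWeakSolution c κ (cuspon c κ) ∧ ¬ IsTrivial (cuspon c κ) ∧
      singularSet κ (cuspon c κ) = {0}) ∧
    ∀ u : ℝ → ℂ, MemEnergySpace u → IsWeakSolution c κ u → singularSet κ u = {0} →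
      (∃ φ : ℝ, ∀ x, u x = Complex.exp (Complex.I * (φ : ℂ)) * cuspon c κ x) ∧
      nonDiffSet u = {0} := by
  refine ⟨h.bijOn_cuspFun, ⟨h.memEnergySpace_cuspon, h.isWeakSolution_cuspon,
    h.not_isTrivial_cuspon, h.singularSet_cuspon⟩, fun u hu hsol hsing => ?_⟩
  obtain ⟨v, hclassical, hv⟩ := exists_isClassicalSolutionOn h.kappa_pos hu hsol
  rw [hsing] at hclassical
  obtain ⟨φ, hφ⟩ := hclassical.exists_phase h hu.1 hu.2.1 hv hsing
  refine ⟨⟨φ, hφ⟩, ?_⟩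
  rw [funext hφ]
  exact h.nonDiffSet_const_mul_cuspon (Complex.exp_ne_zero _)

end

end Cuspon

/-- Cuspons: for `(c, κ) ∈ D̃` the function defining the profile is a bijection from its interval onto
`[0, ∞)` (so that the profile is a genuine inverse); the explicit cuspon is a nontrivial finite-energy
weak solution with singular set `{0}`; and every such solution is this cuspon up to a phase shift and
fails to be differentiable exactly at `0`. -/
theorem corollary1p4 (c κ : ℝ) (hcκ : (c, κ) ∈ Cuspon.regionDtilde) :
    Set.BijOn (Cuspon.cuspFun c κ) (Cuspon.profileRange κ) (Set.Ici 0) ∧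
    (Cuspon.MemEnergySpace (Cuspon.cuspon c κ) ∧
      Cuspon.IsWeakSolution c κ (Cuspon.cuspon c κ) ∧
      ¬ Cuspon.IsTrivial (Cuspon.cuspon c κ) ∧
      Cuspon.singularSet κ (Cuspon.cuspon c κ) = {0}) ∧
    ∀ u : ℝ → ℂ, Cuspon.MemEnergySpace u → Cuspon.IsWeakSolution c κ u →
      ¬ Cuspon.IsTrivial u → Cuspon.singularSet κ u = {0} →
        (∃ φ : ℝ, ∀ x, u x = Complex.exp (Complex.I * (φ : ℂ)) * Cuspon.cuspon c κ x) ∧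
        Cuspon.nonDiffSet u = {0} := by
  have h := Cuspon.corollary1p4_general (Cuspon.isCuspParam_of_mem_regionDtilde hcκ)
  exact ⟨h.1, h.2.1, fun u hu hsol _ => h.2.2 u hu hsol⟩
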